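/- For a positive integer $m$ let $\mathbb H_m$ be the space of complex Hermitian $m\times m$ matrices with inner product $\langle A,B\rangle=\mathrm{tr}(AB)$, let $\|\cdot\|$ be the operator norm, and let $\mathcal X=\{E_{kj}:1\le k,j\le m\}$ be the orthonormal basis of $\mathbb H_m$ given by $E_{kk}=e_ke_k^{T}$ and, for $k<j$, $E_{jk}=\frac1{\sqrt2}(e_ke_j^{T}+e_je_k^{T})$, $E_{kj}=\frac{i}{\sqrt2}(e_ke_j^{T}-e_je_k^{T})$. For $\beta,L>0$ the Hölder class $\Sigma(\beta,L)$ consists of the functions $f:[0,1]\to\mathbb R$ that are $\ell=\lfloor\beta\rfloor$ times differentiable with $|f^{(\ell)}(x)-f^{(\ell)}(x')|\le L|x-x'|^{\beta-\ell}$ for all $x,x'\in[0,1]$. Let $\ell\ge 0$ be an integer and let $K:\mathbb R\to\mathbb R$ be symmetric, supported in $[-1,1]$, square integrable, Lipschitz, and of order $\ell$, i.e. $\int K=1$ and $\int u^jK(u)\,du=0$ for $1\le j\le\ell$. Let $c_*>0$ and $B>0$. Then there is a constant $C^*>0$, depending only on $K$, $\ell$, $c_*$ and $B$, with the following property. Let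 $\beta,L,a>0$ with $\lfloor\beta\rfloor=\ell$ and $L\le Ba$, let $m,n\ge1$ be integers, and let $A:[0,1]\to\mathbb H_m$ be a matrix valued function (of arbitrary rank) such that * for some constant $a_1$, $|\langle A(t),X\rangle|\le a_1$ for all $t\in[0,1]$ and all $X\in\mathcal X$; * the real and imaginary parts of every entry $A_{ij}$ belong to $\Sigma(\beta,L)$. Let $(\tau_j,X_j,Y_j)$, $j=1,\dots,n$, be i.i.d. random triplets such that $\tau_j$ is uniform on $[0,1]$, $X_j$ is uniform on $\mathcal X$, $\tau_j$ and $X_j$ are independent, $|Y_j|\le a$ almost surely, and $\mathbb E(Y_j\mid\tau_j,X_j)=\langle A(\tau_j),X_j\rangle$. Put $$h=c_*\Big(\frac{a^2(\ell!)^2\,m\log n}{2\beta L^2n}\Big)^{\frac1{2\beta+1}},\qquad \tilde A(t)=\frac{m^2}{nh}\sum_{j=1}^nK\Big(\frac{\tau_j-t}{h}\Big)Y_jX_j .$$ Then, with probability at least $1-n^{-2}$, $$\sup_{t\in[h,1-h]}\frac1{m^2}\big\|\tilde A(t)-A(t)\big\|^2\le C^*L^2\Big(\frac{a^2(\ell!)^2\,m\log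 n}{2\beta L^2n}\Big)^{\frac{2\beta}{2\beta+1}}$$ (there is nothing to prove if $[h,1-h]$ is empty). -/

import Mathlib

open MeasureTheory ProbabilityTheory Set

noncomputable section

namespace MatrixFunctionEstimation

/-- The Hölder class `Σ(β, L)` on `[0, 1]`: functions that are `⌊β⌋` times differentiable on
`[0, 1]` (one-sided at the endpoints), whose derivative of order `⌊β⌋` is Hölder of exponent
`β - ⌊β⌋` with constant `L`. -/
def HolderClass (β L : ℝ) (f : ℝ → ℝ) : Prop :=
  (∀ k < ⌊β⌋₊, DifferentiableOn ℝ (iteratedDerivWithin k f (Icc 0 1)) (Icc 0 1)) ∧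
  ∀ x ∈ Icc (0 : ℝ) 1, ∀ x' ∈ Icc (0 : ℝ) 1,
    |iteratedDerivWithin ⌊β⌋₊ f (Icc 0 1) x - iteratedDerivWithin ⌊β⌋₊ f (Icc 0 1) x'|
      ≤ L * |x - x'| ^ (β - (⌊β⌋₊ : ℝ))

/-- `K` is a kernel of order `ℓ`: the functions `u ^ j * K u`, `0 ≤ j ≤ ℓ`, are integrable, `K` has
integral one, and its moments of orders `1, …, ℓ` vanish. -/
structure IsKernelOfOrder (K : ℝ → ℝ) (ℓ : ℕ) : Prop where
  integrable_moment : ∀ j ≤ ℓ, Integrable (fun u : ℝ => u ^ j * K u)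
  integral_eq_one : ∫ u, K u = 1
  moment_eq_zero : ∀ j, 1 ≤ j → j ≤ ℓ → ∫ u, u ^ j * K u = 0

/-- The assumptions on the kernel: symmetric, supported in `[-1, 1]`, square integrable, of order
`ℓ`, and Lipschitz. -/
structure IsAdmissibleKernel (K : ℝ → ℝ) (ℓ : ℕ) : Prop where
  symmetric : ∀ u, K (-u) = K u
  support_subset : Function.support K ⊆ Icc (-1) 1
  sq_integrable : Integrable (fun u => K u ^ 2)
  order : IsKernelOfOrder K ℓ
  lipschitz : ∃ LK : NNReal, 0 < LK ∧ LipschitzWith LK K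

/-- Matrices carry the product (equivalently, Borel) σ-algebra of their entries. -/
instance instMeasurableSpaceComplexMatrix (m : ℕ) :
    MeasurableSpace (Matrix (Fin m) (Fin m) ℂ) :=
  inferInstanceAs (MeasurableSpace (Fin m → Fin m → ℂ))

/-- The matrix `E_{kj}` of the standard orthonormal basis of the real vector space of `m × m`
Hermitian matrices. -/
def basisMatrix (m : ℕ) (k j : Fin m) : Matrix (Fin m) (Fin m) ℂ :=
  if k = j then Matrix.single k k 1
  else if j < k then
    ((1 / Real.sqrt 2 : ℝ) : ℂ) • (Matrix.single j k 1 + Matrix.single k j 1)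
  else
    (Complex.I * ((1 / Real.sqrt 2 : ℝ) : ℂ)) • (Matrix.single k j 1 - Matrix.single j k 1)

/-- The set `𝒳` of sampling matrices. -/
def samplingSet (m : ℕ) : Set (Matrix (Fin m) (Fin m) ℂ) :=
  {E | ∃ k j, E = basisMatrix m k j}

/-- The inner product `⟨A, B⟩ = tr (A B)` of Hermitian matrices; this trace is a real number. -/
def hsInner {m : ℕ} (A B : Matrix (Fin m) (Fin m) ℂ) : ℝ :=
  (A * B).trace.re

/-- The operator (spectral) norm of a matrix. -/
def opNorm {m : ℕ} (A : Matrix (Fin m) (Fin m) ℂ) : ℝ :=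
  ‖Matrix.toEuclideanCLM (n := Fin m) (𝕜 := ℂ) A‖

/-- The values `A t`, `t ∈ [0, 1]`, are Hermitian. -/
def IsHermitianValued {m : ℕ} (A : ℝ → Matrix (Fin m) (Fin m) ℂ) : Prop :=
  ∀ t ∈ Icc (0 : ℝ) 1, (A t).IsHermitian

/-- `|⟨A t, X⟩| ≤ a₁` for every `t ∈ [0, 1]` and every sampling matrix `X`. -/
def IsBoundedOnSampling {m : ℕ} (a₁ : ℝ) (A : ℝ → Matrix (Fin m) (Fin m) ℂ) : Prop :=
  ∀ t ∈ Icc (0 : ℝ) 1, ∀ E ∈ samplingSet m, |hsInner (A t) E| ≤ a₁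

/-- All entries of `A` are in the Hölder class, i.e. their real and imaginary parts are. (This
holds in particular if the Hölder condition holds in modulus for the complex entries.) -/
def HasHolderEntries {m : ℕ} (β L : ℝ) (A : ℝ → Matrix (Fin m) (Fin m) ℂ) : Prop :=
  ∀ i j, HolderClass β L (fun t => (A t i j).re) ∧ HolderClass β L (fun t => (A t i j).im)

/-- The observation model: `(τ_j, X_j, Y_j)` are i.i.d.; `τ_j` is uniform on `[0, 1]`, `X_j` is
uniform on `𝒳`, `τ_j` and `X_j` are independent, `|Y_j| ≤ a` almost surely, and
`E (Y_j | τ_j, X_j) = ⟨A (τ_j), X_j⟩`. -/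
structure IsSample {Ω : Type*} [MeasurableSpace Ω] (P : Measure Ω) {m n : ℕ}
    (A : ℝ → Matrix (Fin m) (Fin m) ℂ) (a : ℝ)
    (τ : Fin n → Ω → ℝ) (X : Fin n → Ω → Matrix (Fin m) (Fin m) ℂ) (Y : Fin n → Ω → ℝ) :
    Prop where
  measurable_time : ∀ j, Measurable (τ j)
  measurable_design : ∀ j, Measurable (X j)
  measurable_response : ∀ j, Measurable (Y j)
  indep : iIndepFun (fun j ω => (τ j ω, X j ω, Y j ω)) P
  identDistrib : ∀ i j,
    IdentDistrib (fun ω => (τ i ω, X i ω, Y i ω)) (fun ω => (τ j ω, X j ω, Y j ω)) P P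
  law_time : ∀ j, P.map (τ j) = volume.restrict (Icc (0 : ℝ) 1)
  law_design : ∀ j, P.map (X j) = uniformOn (samplingSet m)
  indep_time_design : ∀ j, IndepFun (τ j) (X j) P
  bounded_response : ∀ j, ∀ᵐ ω ∂P, |Y j ω| ≤ a
  regression : ∀ j,
    P[Y j | MeasurableSpace.comap (fun ω => (τ j ω, X j ω)) inferInstance]
      =ᵐ[P] fun ω => hsInner (A (τ j ω)) (X j ω)

/-- The kernel estimator `(m² / (n h)) ∑_j K ((τ_j - t) / h) Y_j X_j`. -/
def kernelEstimator {m n : ℕ} (K : ℝ → ℝ) (h : ℝ) (τ : Fin n → ℝ)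
    (X : Fin n → Matrix (Fin m) (Fin m) ℂ) (Y : Fin n → ℝ) (t : ℝ) :
    Matrix (Fin m) (Fin m) ℂ :=
  ((m : ℝ) ^ 2 / (n * h)) • ∑ j, (K ((τ j - t) / h) * Y j) • X j

/-- The quantity `a² (⌊β⌋!)² m log n / (2 β L² n)`. -/
def rateBase (β L a : ℝ) (m n : ℕ) : ℝ :=
  a ^ 2 * (Nat.factorial ⌊β⌋₊ : ℝ) ^ 2 * m * Real.log n / (2 * β * L ^ 2 * n)

/-- The bandwidth `c (a² (⌊β⌋!)² m log n / (2 β L² n)) ^ (1 / (2 β + 1))`. -/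
def bandwidth (c β L a : ℝ) (m n : ℕ) : ℝ :=
  c * rateBase β L a m n ^ (1 / (2 * β + 1))

end MatrixFunctionEstimation

end

/-! The error splits as `(m² / (n h)) D(t) + h⁻¹ (S(t) - h A(t))`, where `S(t) = ∫ K((s - t) / h)
A(s) ds` over `[0, 1]` and `D(t)` is the sum of the centred terms `K((τ_j - t) / h) Y_j X_j`. The
mean of a term is `m⁻² S(t)`: conditioning on `(τ, X)` replaces `Y` by `⟨A(τ), X⟩`, and `⟨B, X⟩ X`
averages to `m⁻² B` because `𝒳` is an orthonormal basis (`IsSample.integral_truncatedTerm`).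

Bias (`norm_smoothing_sub_le`): Taylor expansion and the vanishing moments of `K` give `O(L h^β)` in
every entry. Passing to the operator norm costs a factor `m`, which the normalisation `1 / m²` of
the squared norm absorbs.

Deviation: the terms are `O(a)` in norm, with second moment `O(h a² / m)` times the identity; the
gain `1 / m` comes from `∑ E² = m I` over `𝒳`. The matrix Bernstein inequality
(`measureReal_bernstein_le`) follows by peeling off one summand at a time with Golden–Thompson
(`trace_exp_add_le`), itself a consequence of dyadic trace inequalities and the Lie–Trotter formula.
A grid of mesh `h / n` and the Lipschitz property of `K` make it uniform in `t`. Terms are truncated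
on a null event so that their bounds hold everywhere.

Balance: put `q = m log n / (n h)`. The bandwidth gives `a² q ≲ L² h^(2β)`, and then `L ≤ B a`
together with `h ≤ 1/2` bounds `q` by a constant `Q`. This bound is used twice: the linear Bernstein
term, of order `a q`, is dominated by the square root term `a √q`, and the product of grid size and
dimension is polynomial in `n`, so a level `r = κ log n` suffices. If `h > 1/2`, the range of `t` is
empty. -/

namespace MatrixFunctionEstimation

/-! ### The Golden–Thompson inequality -/

section GoldenThompson

open scoped Matrix Matrix.Norms.L2Operator ComplexOrder

variable {ι : Type*} [Fintype ι] [DecidableEq ι]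

omit [DecidableEq ι] in
/-- The Cauchy–Schwarz inequality for the Hilbert–Schmidt inner product. -/
theorem norm_trace_mul_sq_le (X Y : Matrix ι ι ℂ) :
    ‖(X * Y).trace‖ ^ 2 ≤ (X * Xᴴ).trace.re * (Y * Yᴴ).trace.re := by
  have key : ∀ Z : Matrix ι ι ℂ, (Z * Zᴴ).trace.re = ∑ p : ι × ι, ‖Z p.1 p.2‖ ^ 2 := by
    intro Z
    simp only [Matrix.trace, Matrix.diag, Matrix.mul_apply, Matrix.conjTranspose_apply,
      Fintype.sum_prod_type, Complex.re_sum]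
    refine Finset.sum_congr rfl fun i _ => Finset.sum_congr rfl fun j _ => ?_
    rw [RCLike.star_def, Complex.mul_conj, Complex.ofReal_re, Complex.normSq_eq_norm_sq]
  rw [key, key Y, ← Equiv.sum_comp (Equiv.prodComm ι ι) (fun p => ‖Y p.1 p.2‖ ^ 2)]
  have h1 : ‖(X * Y).trace‖ ≤ ∑ p : ι × ι, ‖X p.1 p.2‖ * ‖Y p.2 p.1‖ := by
    simp only [Matrix.trace, Matrix.diag, Matrix.mul_apply, Fintype.sum_prod_type]
    refine (norm_sum_le _ _).trans (Finset.sum_le_sum fun i _ => ?_)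
    refine (norm_sum_le _ _).trans (Finset.sum_le_sum fun j _ => ?_)
    rw [norm_mul]
  refine (pow_le_pow_left₀ (norm_nonneg _) h1 2).trans ?_
  exact Finset.sum_mul_sq_le_sq_mul_sq _ _ _

theorem trace_mul_pow_comm (A B : Matrix ι ι ℂ) (k : ℕ) :
    ((A * B) ^ k).trace = ((B * A) ^ k).trace := by
  cases k with
  | zero => simp
  | succ k =>
    have h : (A * B) ^ (k + 1) = A * ((B * A) ^ k * B) := by
      rw [pow_succ', mul_assoc]
      congr 1
      induction k with
      | zero => simp
      | succ k ih => rw [pow_succ', pow_succ', mul_assoc (B * A), ← ih]; noncomm_ring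
    rw [h, Matrix.trace_mul_comm, mul_assoc, ← pow_succ]

/-- The two bounds feed each other, hence the joint induction. The second at `k + 1` is the first at
`k` for `X = A B`, followed by the second at `k` for `A²`, `B²`. The first at `k + 1` is the first
at `k` for `X²`, which yields the product of `P = Xᴴ X` and `Q = X Xᴴ`; then come the second at `k`
and Cauchy–Schwarz, the powers of `P` and `Q` having equal traces. -/
theorem trace_dyadic_bounds (k : ℕ) :
    (∀ X : Matrix ι ι ℂ, ‖(X ^ (2 * 2 ^ k)).trace‖ ≤ ((X * Xᴴ) ^ 2 ^ k).trace.re) ∧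
    (∀ A B : Matrix ι ι ℂ, A.IsHermitian → B.IsHermitian →
      ((A * B) ^ 2 ^ k).trace.re ≤ (A ^ 2 ^ k * B ^ 2 ^ k).trace.re) := by
  induction k with
  | zero =>
    refine ⟨fun X => ?_, fun A B _ _ => by simp⟩
    have h := norm_trace_mul_sq_le X X
    have h0 : 0 ≤ (X * Xᴴ).trace.re :=
      (Complex.nonneg_iff.1 (Matrix.posSemidef_self_mul_conjTranspose X).trace_nonneg).1
    simp only [pow_zero, mul_one, pow_one]
    rw [pow_two X]
    exact abs_le_of_sq_le_sq' (by nlinarith) h0 |>.2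
  | succ k ih =>
    obtain ⟨ihX, ihAB⟩ := ih
    refine ⟨fun X => ?_, fun A B hA hB => ?_⟩
    · have e1 : X ^ (2 * 2 ^ (k + 1)) = (X ^ 2) ^ (2 * 2 ^ k) := by
        rw [← pow_mul]; congr 1; ring
      set P := Xᴴ * X with hP
      set Q := X * Xᴴ with hQ
      have hPh : P.IsHermitian := Matrix.isHermitian_conjTranspose_mul_self X
      have hQh : Q.IsHermitian := Matrix.isHermitian_mul_conjTranspose_self X
      have h1 : ‖(X ^ (2 * 2 ^ (k + 1))).trace‖ ≤ ((P * Q) ^ 2 ^ k).trace.re := by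
        rw [e1]
        refine (ihX (X ^ 2)).trans (le_of_eq ?_)
        have : X ^ 2 * (X ^ 2)ᴴ = X * (Q * Xᴴ) := by
          rw [hQ, pow_two, Matrix.conjTranspose_mul]; noncomm_ring
        rw [this, trace_mul_pow_comm, trace_mul_pow_comm P Q, hP, ← mul_assoc, mul_assoc]
      have h2 := h1.trans (ihAB P Q hPh hQh)
      have h3 := norm_trace_mul_sq_le (P ^ 2 ^ k) (Q ^ 2 ^ k)
      rw [(hPh.pow _).eq, (hQh.pow _).eq, ← pow_add, ← pow_add, ← two_mul, ← pow_succ',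
        trace_mul_pow_comm Xᴴ X, ← hQ] at h3
      have h0 : 0 ≤ (Q ^ 2 ^ (k + 1)).trace.re :=
        (Complex.nonneg_iff.1 (((Matrix.posSemidef_self_mul_conjTranspose X).pow _).trace_nonneg)).1
      have h4 : ‖(P ^ 2 ^ k * Q ^ 2 ^ k).trace‖ ≤ (Q ^ 2 ^ (k + 1)).trace.re :=
        abs_le_of_sq_le_sq' (by nlinarith) h0 |>.2
      exact h2.trans ((Complex.re_le_norm _).trans h4)
    · have e1 : (A * B) ^ 2 ^ (k + 1) = (A * B) ^ (2 * 2 ^ k) := by rw [pow_succ']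
      have e2 : ((A * B * (A * B)ᴴ) ^ 2 ^ k).trace = ((A ^ 2 * B ^ 2) ^ 2 ^ k).trace := by
        have : A * B * (A * B)ᴴ = A * (B ^ 2 * A) := by
          rw [Matrix.conjTranspose_mul, hA.eq, hB.eq]; noncomm_ring
        rw [this, trace_mul_pow_comm, trace_mul_pow_comm (A ^ 2), mul_assoc, ← pow_two]
      have h := ihX (A * B)
      rw [e2] at h
      have h2 := ihAB (A ^ 2) (B ^ 2) (hA.pow 2) (hB.pow 2)
      rw [← pow_mul, ← pow_mul, ← pow_succ'] at h2
      rw [e1]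
      exact (Complex.re_le_norm _).trans (h.trans h2)

theorem norm_pow_sub_pow_le_of_norm_le {R : Type*} [NormedRing R] [NormOneClass R] {x z : R} {r : ℝ}
    (hx : ‖x‖ ≤ r) (hz : ‖z‖ ≤ r) (hr : 1 ≤ r) (k : ℕ) :
    ‖x ^ k - z ^ k‖ ≤ k * r ^ k * ‖x - z‖ := by
  induction k with
  | zero => simp
  | succ k ih =>
    have e : x ^ (k + 1) - z ^ (k + 1) = x ^ k * (x - z) + (x ^ k - z ^ k) * z := by
      rw [pow_succ, pow_succ]; noncomm_ring
    rw [e]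
    have hr0 : 0 ≤ r := by linarith
    have h1 : ‖x ^ k * (x - z)‖ ≤ r ^ k * ‖x - z‖ :=
      (norm_mul_le _ _).trans (mul_le_mul_of_nonneg_right
        ((norm_pow_le _ _).trans (pow_le_pow_left₀ (norm_nonneg _) hx k)) (norm_nonneg _))
    have h2 : ‖(x ^ k - z ^ k) * z‖ ≤ k * r ^ k * ‖x - z‖ * r :=
      (norm_mul_le _ _).trans (mul_le_mul ih hz (norm_nonneg _) (by positivity))
    have h3 : r ^ k * ‖x - z‖ ≤ r ^ (k + 1) * ‖x - z‖ :=
      mul_le_mul_of_nonneg_right (pow_le_pow_right₀ hr (Nat.le_succ k)) (norm_nonneg _)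
    refine (norm_add_le _ _).trans ((add_le_add (h1.trans h3) h2).trans (le_of_eq ?_))
    push_cast; ring

open Filter Topology NormedSpace in
/-- The Lie–Trotter product formula, along powers of two. -/
theorem tendsto_exp_mul_exp_pow {R : Type*} [NormedRing R] [NormOneClass R] [NormedAlgebra ℝ R]
    [CompleteSpace R] (a b : R) :
    Tendsto (fun k : ℕ => (exp (((2 : ℝ) ^ k)⁻¹ • a) * exp (((2 : ℝ) ^ k)⁻¹ • b)) ^ 2 ^ k) atTop
      (𝓝 (exp (a + b))) := by
  have hd : ∀ c : R, HasDerivAt (fun s : ℝ => exp (s • c)) c 0 := fun c => by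
    simpa using hasDerivAt_exp_smul_const (𝕂 := ℝ) c (0 : ℝ)
  have hx := hd (a + b)
  have hz : HasDerivAt (fun s : ℝ => exp (s • a) * exp (s • b)) (a + b) 0 := by
    simpa [Pi.mul_def] using (hd a).mul (hd b)
  have hs : Tendsto (fun k : ℕ => ((2 : ℝ) ^ k)⁻¹) atTop (𝓝[≠] 0) := by
    refine tendsto_nhdsWithin_iff.2 ⟨?_, Eventually.of_forall fun k => by simp⟩
    exact tendsto_inv_atTop_zero.comp (tendsto_pow_atTop_atTop_of_one_lt one_lt_two)
  -- Both curves `s ↦ exp (s (a + b))` and `s ↦ exp (s a) exp (s b)` have derivative `a + b` at `0`,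
  -- so their difference is `o(s)`. Telescoping the `2 ^ k`-th powers costs only `2 ^ k` times a
  -- factor bounded by `exp C`.
  have hdiff : Tendsto (fun k : ℕ => (2 : ℝ) ^ k * ‖exp (((2 : ℝ) ^ k)⁻¹ • (a + b)) -
      exp (((2 : ℝ) ^ k)⁻¹ • a) * exp (((2 : ℝ) ^ k)⁻¹ • b)‖) atTop (𝓝 0) := by
    have h := ((hx.sub hz).tendsto_slope_zero.comp hs).norm
    simp only [sub_self, norm_zero] at h
    refine h.congr fun k => ?_
    simp [norm_smul]
  have hbound : ∀ f : ℝ → R, f 0 = 1 → HasDerivAt f (a + b) 0 →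
      ∀ᶠ k : ℕ in atTop, ‖f ((2 : ℝ) ^ k)⁻¹‖ ≤ 1 + (‖a + b‖ + 1) / 2 ^ k := by
    intro f hf0 hf
    have h := (hf.tendsto_slope_zero.comp hs).norm
    filter_upwards [h.eventually_le_const (lt_add_one _)] with k hk
    have hp : (0 : ℝ) < 2 ^ k := by positivity
    simp only [Function.comp, zero_add, hf0, norm_smul, inv_inv, norm_pow, Real.norm_ofNat] at hk
    have h1 : ‖f ((2 : ℝ) ^ k)⁻¹ - 1‖ ≤ (‖a + b‖ + 1) / 2 ^ k := by
      rw [le_div_iff₀ hp]; linarith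
    calc ‖f ((2 : ℝ) ^ k)⁻¹‖ = ‖1 + (f ((2 : ℝ) ^ k)⁻¹ - 1)‖ := by congr 1; abel
      _ ≤ ‖(1 : R)‖ + ‖f ((2 : ℝ) ^ k)⁻¹ - 1‖ := norm_add_le _ _
      _ ≤ _ := by rw [norm_one]; linarith
  have hpow : ∀ k : ℕ, exp (((2 : ℝ) ^ k)⁻¹ • (a + b)) ^ 2 ^ k = exp (a + b) := by
    intro k
    let _ : NormedAlgebra ℚ R := NormedAlgebra.restrictScalars ℚ ℝ R
    rw [← exp_nsmul, ← Nat.cast_smul_eq_nsmul ℝ, smul_smul]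
    simp
  rw [tendsto_iff_norm_sub_tendsto_zero]
  set C := ‖a + b‖ + 1
  have hup : Tendsto (fun k : ℕ => Real.exp C * ((2 : ℝ) ^ k *
      ‖exp (((2 : ℝ) ^ k)⁻¹ • (a + b)) -
      exp (((2 : ℝ) ^ k)⁻¹ • a) * exp (((2 : ℝ) ^ k)⁻¹ • b)‖)) atTop (𝓝 0) := by
    simpa using hdiff.const_mul (Real.exp C)
  refine squeeze_zero' (Eventually.of_forall fun _ => norm_nonneg _) ?_ hup
  filter_upwards [hbound _ (by simp) hx, hbound _ (by simp) hz] with k h1 h2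
  have hC : 0 ≤ C := by positivity
  have h3 := norm_pow_sub_pow_le_of_norm_le h1 h2
    (le_add_of_nonneg_right (by positivity)) (2 ^ k)
  rw [hpow, norm_sub_rev] at h3
  refine h3.trans ?_
  have h4 : (1 + C / 2 ^ k) ^ 2 ^ k ≤ Real.exp C := by
    have := Real.add_one_le_exp (C / 2 ^ k)
    calc (1 + C / 2 ^ k) ^ 2 ^ k ≤ Real.exp (C / 2 ^ k) ^ 2 ^ k :=
          pow_le_pow_left₀ (by positivity) (by linarith) _
      _ = Real.exp C := by
          rw [← Real.exp_nat_mul]; congr 1; push_cast; field_simp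
  push_cast
  calc _ = (1 + C / 2 ^ k) ^ 2 ^ k * (2 ^ k * ‖exp (((2 : ℝ) ^ k)⁻¹ • (a + b)) -
        exp (((2 : ℝ) ^ k)⁻¹ • a) * exp (((2 : ℝ) ^ k)⁻¹ • b)‖) := by ring
    _ ≤ _ := mul_le_mul_of_nonneg_right h4 (by positivity)

open Filter Topology in
/-- The Golden–Thompson inequality. -/
theorem trace_exp_add_le {A B : Matrix ι ι ℂ} (hA : A.IsHermitian) (hB : B.IsHermitian) :
    (NormedSpace.exp (A + B)).trace.re ≤ (NormedSpace.exp A * NormedSpace.exp B).trace.re := by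
  cases isEmpty_or_nonempty ι
  · simp [Matrix.trace]
  have hlim := tendsto_exp_mul_exp_pow A B
  have hc : Continuous fun M : Matrix ι ι ℂ => M.trace.re :=
    Complex.continuous_re.comp continuous_id.matrix_trace
  refine le_of_tendsto ((hc.tendsto _).comp hlim) (Eventually.of_forall fun k => ?_)
  have hpow : ∀ M : Matrix ι ι ℂ, NormedSpace.exp (((2 : ℝ) ^ k)⁻¹ • M) ^ 2 ^ k =
      NormedSpace.exp M := by
    intro M
    rw [← Matrix.exp_nsmul, ← Nat.cast_smul_eq_nsmul ℝ, smul_smul]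
    simp
  have hherm : ∀ M : Matrix ι ι ℂ, M.IsHermitian →
      (NormedSpace.exp (((2 : ℝ) ^ k)⁻¹ • M)).IsHermitian := fun M hM =>
    Matrix.IsHermitian.exp (by
      rw [Matrix.IsHermitian, Matrix.conjTranspose_smul, hM.eq, star_trivial])
  have h := (trace_dyadic_bounds k).2 _ _ (hherm A hA) (hherm B hB)
  rwa [hpow, hpow] at h

end GoldenThompson

end MatrixFunctionEstimation

namespace MatrixFunctionEstimation

open scoped Matrix Matrix.Norms.L2Operator ComplexOrder

/-! ### Exponentials of Hermitian matrices through the spectral theorem -/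

section HermitianMatrix

variable {ι : Type*} [Fintype ι] [DecidableEq ι]

theorem exp_conj_diagonal (U : Matrix.unitaryGroup ι ℂ) (d : ι → ℝ) :
    NormedSpace.exp ((U : Matrix ι ι ℂ) * Matrix.diagonal (fun i => (d i : ℂ)) * star (U : Matrix ι ι ℂ)) =
      U * Matrix.diagonal (fun i => (Real.exp (d i) : ℂ)) * star (U : Matrix ι ι ℂ) := by
  have hU : (U : Matrix ι ι ℂ)⁻¹ = star (U : Matrix ι ι ℂ) :=
    Matrix.inv_eq_right_inv (Matrix.mem_unitaryGroup_iff.1 U.2)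
  have hunit : IsUnit (U : Matrix ι ι ℂ) :=
    ⟨⟨U, star U, Matrix.mem_unitaryGroup_iff.1 U.2, Matrix.mem_unitaryGroup_iff'.1 U.2⟩, rfl⟩
  rw [← hU, Matrix.exp_conj _ _ hunit, Matrix.exp_diagonal]
  congr 3
  funext i
  rw [Pi.coe_exp, ← Complex.exp_eq_exp_ℂ, Complex.ofReal_exp]

theorem trace_conj_diagonal (U : Matrix.unitaryGroup ι ℂ) (d : ι → ℂ) :
    ((U : Matrix ι ι ℂ) * Matrix.diagonal d * star (U : Matrix ι ι ℂ)).trace = ∑ i, d i := by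
  rw [Matrix.trace_mul_comm, ← mul_assoc, Matrix.mem_unitaryGroup_iff'.1 U.2, one_mul,
    Matrix.trace_diagonal]

theorem norm_conj_diagonal (U : Matrix.unitaryGroup ι ℂ) (d : ι → ℂ) :
    ‖(U : Matrix ι ι ℂ) * Matrix.diagonal d * star (U : Matrix ι ι ℂ)‖ = ‖d‖ := by
  have h := CStarRing.norm_mul_coe_unitary ((U : Matrix ι ι ℂ) * Matrix.diagonal d) (star U)
  rw [Unitary.coe_star] at h
  rw [h, CStarRing.norm_coe_unitary_mul, Matrix.l2_opNorm_diagonal]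

theorem _root_.Matrix.IsHermitian.exists_eq_conj_diagonal {A : Matrix ι ι ℂ} (hA : A.IsHermitian) :
    ∃ (U : Matrix.unitaryGroup ι ℂ) (d : ι → ℝ),
      A = (U : Matrix ι ι ℂ) * Matrix.diagonal (fun i => (d i : ℂ)) * star (U : Matrix ι ι ℂ) :=
  ⟨hA.eigenvectorUnitary, hA.eigenvalues, hA.spectral_theorem⟩

theorem norm_exp_le_of_isHermitian {A : Matrix ι ι ℂ} (hA : A.IsHermitian) :
    ‖NormedSpace.exp A‖ ≤ Real.exp ‖A‖ := by
  obtain ⟨U, d, rfl⟩ := hA.exists_eq_conj_diagonal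
  rw [exp_conj_diagonal, norm_conj_diagonal, norm_conj_diagonal]
  refine (pi_norm_le_iff_of_nonneg (Real.exp_nonneg _)).2 fun i => ?_
  rw [Complex.norm_real, Real.norm_eq_abs, Real.abs_exp]
  refine Real.exp_le_exp.2 ((le_abs_self _).trans ?_)
  have := norm_le_pi_norm (fun i => (d i : ℂ)) i
  rwa [Complex.norm_real, Real.norm_eq_abs] at this

theorem posSemidef_exp {A : Matrix ι ι ℂ} (hA : A.IsHermitian) :
    (NormedSpace.exp A).PosSemidef := by
  obtain ⟨U, d, rfl⟩ := hA.exists_eq_conj_diagonal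
  rw [exp_conj_diagonal]
  exact (Matrix.PosSemidef.diagonal fun i => by
    exact Complex.zero_le_real.2 (Real.exp_nonneg (d i))).mul_mul_conjTranspose_same _

/-- On eigenvalues this is `exp x ≤ 1 + x + x²` for `|x| ≤ 1`. It is the step that turns a variance
bound into an exponential moment bound. -/
theorem posSemidef_one_add_add_sq_sub_exp {A : Matrix ι ι ℂ} (hA : A.IsHermitian) (h1 : ‖A‖ ≤ 1) :
    (1 + A + A * A - NormedSpace.exp A).PosSemidef := by
  obtain ⟨U, d, rfl⟩ := hA.exists_eq_conj_diagonal
  rw [norm_conj_diagonal] at h1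
  rw [exp_conj_diagonal]
  have hU := Matrix.mem_unitaryGroup_iff.1 U.2
  have hU' := Matrix.mem_unitaryGroup_iff'.1 U.2
  have e : 1 + (U : Matrix ι ι ℂ) * Matrix.diagonal (fun i => (d i : ℂ)) * star (U : Matrix ι ι ℂ) +
      (U : Matrix ι ι ℂ) * Matrix.diagonal (fun i => (d i : ℂ)) * star (U : Matrix ι ι ℂ) *
      ((U : Matrix ι ι ℂ) * Matrix.diagonal (fun i => (d i : ℂ)) * star (U : Matrix ι ι ℂ)) -
      U * Matrix.diagonal (fun i => (Real.exp (d i) : ℂ)) * star (U : Matrix ι ι ℂ) =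
      U * Matrix.diagonal (fun i => ((1 + d i + d i * d i - Real.exp (d i) : ℝ) : ℂ)) *
        (U : Matrix ι ι ℂ)ᴴ := by
    have e1 : (U : Matrix ι ι ℂ) * Matrix.diagonal (fun i => (d i : ℂ)) * star (U : Matrix ι ι ℂ) *
      ((U : Matrix ι ι ℂ) * Matrix.diagonal (fun i => (d i : ℂ)) * star (U : Matrix ι ι ℂ)) =
      U * (Matrix.diagonal (fun i => (d i : ℂ)) * (star (U : Matrix ι ι ℂ) * U) *
        Matrix.diagonal (fun i => (d i : ℂ))) * star (U : Matrix ι ι ℂ) := by noncomm_ring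
    have e2 : Matrix.diagonal (fun i => ((1 + d i + d i * d i - Real.exp (d i) : ℝ) : ℂ)) =
        1 + Matrix.diagonal (fun i => (d i : ℂ)) + Matrix.diagonal (fun i => (d i : ℂ)) *
          Matrix.diagonal (fun i => (d i : ℂ)) - Matrix.diagonal (fun i => (Real.exp (d i) : ℂ)) := by
      rw [Matrix.diagonal_mul_diagonal, ← Matrix.diagonal_one, Matrix.diagonal_add,
        Matrix.diagonal_add, Matrix.diagonal_sub]
      congr 1; funext i; push_cast; rfl
    rw [e1, hU', e2, ← Matrix.star_eq_conjTranspose, mul_one]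
    conv_lhs => rw [← hU]
    noncomm_ring
  rw [e]
  refine (Matrix.PosSemidef.diagonal fun i => ?_).mul_mul_conjTranspose_same _
  have hd : |d i| ≤ 1 := by
    have := norm_le_pi_norm (fun i => (d i : ℂ)) i
    rw [Complex.norm_real, Real.norm_eq_abs] at this
    exact this.trans h1
  have := abs_le.1 (Real.abs_exp_sub_one_sub_id_le hd)
  exact Complex.zero_le_real.2 (by nlinarith)

/-- The eigenvalue of largest modulus contributes `exp ‖A‖` to one of the two traces, depending on
its sign; all other contributions are positive. -/
theorem exp_norm_le_trace_exp_add {A : Matrix ι ι ℂ} [Nonempty ι] (hA : A.IsHermitian) :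
    Real.exp ‖A‖ ≤ (NormedSpace.exp A).trace.re + (NormedSpace.exp (-A)).trace.re := by
  obtain ⟨U, d, rfl⟩ := hA.exists_eq_conj_diagonal
  have hneg : -((U : Matrix ι ι ℂ) * Matrix.diagonal (fun i => (d i : ℂ)) * star (U : Matrix ι ι ℂ)) =
      (U : Matrix ι ι ℂ) * Matrix.diagonal (fun i => ((-d i : ℝ) : ℂ)) * star (U : Matrix ι ι ℂ) := by
    have : Matrix.diagonal (fun i => ((-d i : ℝ) : ℂ)) = -Matrix.diagonal (fun i => (d i : ℂ)) := by
      rw [Matrix.diagonal_neg]; congr 1; funext i; push_cast; rfl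
    rw [this]; noncomm_ring
  rw [hneg, exp_conj_diagonal, exp_conj_diagonal, norm_conj_diagonal, trace_conj_diagonal,
    trace_conj_diagonal, Complex.re_sum, Complex.re_sum]
  simp only [Complex.ofReal_re]
  obtain ⟨i, hi⟩ := Finite.exists_max fun i => |d i|
  have h1 : ‖fun i => (d i : ℂ)‖ ≤ |d i| :=
    (pi_norm_le_iff_of_nonneg (abs_nonneg _)).2 fun j => by
      rw [Complex.norm_real, Real.norm_eq_abs]; exact hi j
  have h2 : ∀ e : ι → ℝ, Real.exp (e i) ≤ ∑ j, Real.exp (e j) := fun e =>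
    Finset.single_le_sum (f := fun j => Real.exp (e j)) (fun j _ => Real.exp_nonneg _)
      (Finset.mem_univ i)
  have h3 := Real.exp_abs_le (d i)
  have h4 := Real.exp_le_exp.2 h1
  have h5 := h2 d
  have h6 := h2 (fun j => -d j)
  linarith

open scoped MatrixOrder in
theorem re_trace_mul_nonneg {M P : Matrix ι ι ℂ} (hM : M.PosSemidef) (hP : P.PosSemidef) :
    0 ≤ (M * P).trace.re := by
  obtain ⟨B, rfl⟩ := CStarAlgebra.nonneg_iff_eq_star_mul_self.mp
    (Matrix.nonneg_iff_posSemidef.2 hM)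
  rw [mul_assoc, Matrix.trace_mul_comm]
  exact (Complex.nonneg_iff.1 (hP.mul_mul_conjTranspose_same B).trace_nonneg).1

/-- The real bilinear form `(M, N) ↦ Re tr (M N)`. -/
noncomputable def traceMulRe (ι : Type*) [Fintype ι] [DecidableEq ι] :
    Matrix ι ι ℂ →L[ℝ] Matrix ι ι ℂ →L[ℝ] ℝ :=
  (ContinuousLinearMap.compL ℝ (Matrix ι ι ℂ) (Matrix ι ι ℂ) ℝ
    (LinearMap.toContinuousLinearMap
      (Complex.reLm ∘ₗ Matrix.traceLinearMap ι ℝ ℂ))) ∘L ContinuousLinearMap.mul ℝ (Matrix ι ι ℂ)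

@[simp]
theorem traceMulRe_apply (M N : Matrix ι ι ℂ) : traceMulRe ι M N = (M * N).trace.re := rfl

end HermitianMatrix

end MatrixFunctionEstimation

namespace MatrixFunctionEstimation

open scoped Matrix Matrix.Norms.L2Operator ComplexOrder

/-! ### The matrix Bernstein inequality -/

section Bernstein

instance instBorelSpaceComplexMatrix (m : ℕ) : BorelSpace (Matrix (Fin m) (Fin m) ℂ) :=
  inferInstanceAs (BorelSpace (Fin m → Fin m → ℂ))

theorem continuous_matrix_exp (m : ℕ) :
    Continuous (NormedSpace.exp : Matrix (Fin m) (Fin m) ℂ → Matrix (Fin m) (Fin m) ℂ) := by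
  let _ : NormedAlgebra ℚ (Matrix (Fin m) (Fin m) ℂ) := NormedAlgebra.restrictScalars ℚ ℝ _
  exact NormedSpace.exp_continuous

variable {Ω : Type*} [MeasurableSpace Ω] {P : Measure Ω} [IsProbabilityMeasure P] {m : ℕ}
  {κ : Type*}

theorem integrable_of_norm_le {Y : Ω → Matrix (Fin m) (Fin m) ℂ} (hY : Measurable Y) {c : ℝ}
    (h : ∀ ω, ‖Y ω‖ ≤ c) : Integrable Y P :=
  Integrable.of_bound hY.aestronglyMeasurable c (Filter.Eventually.of_forall h)

omit [IsProbabilityMeasure P] in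
theorem integral_traceMulRe_left {Y : Ω → Matrix (Fin m) (Fin m) ℂ} (hY : Integrable Y P)
    (M : Matrix (Fin m) (Fin m) ℂ) :
    ∫ ω, (M * Y ω).trace.re ∂P = (M * ∫ ω, Y ω ∂P).trace.re :=
  (traceMulRe (Fin m) M).integral_comp_comm hY

omit [IsProbabilityMeasure P] in
theorem integrable_traceMulRe_left {Y : Ω → Matrix (Fin m) (Fin m) ℂ} (hY : Integrable Y P)
    (M : Matrix (Fin m) (Fin m) ℂ) : Integrable (fun ω => (M * Y ω).trace.re) P :=
  (traceMulRe (Fin m) M).integrable_comp hY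

/-- Integrate `exp Y ≤ 1 + Y + Y²` against `M`: the linear term vanishes and `1 + v ≤ exp v`. A
general positive semidefinite `M` is needed because it will be the exponential of the other
summands. -/
theorem integral_trace_mul_exp_le {Y : Ω → Matrix (Fin m) (Fin m) ℂ} (hY : Measurable Y)
    (hherm : ∀ ω, (Y ω).IsHermitian) (hnorm : ∀ ω, ‖Y ω‖ ≤ 1) (hmean : ∫ ω, Y ω ∂P = 0) {v : ℝ}
    (hvar : ∀ M : Matrix (Fin m) (Fin m) ℂ, M.PosSemidef →
      ∫ ω, (M * (Y ω * Y ω)).trace.re ∂P ≤ v * M.trace.re)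
    {M : Matrix (Fin m) (Fin m) ℂ} (hM : M.PosSemidef) :
    (M * ∫ ω, NormedSpace.exp (Y ω) ∂P).trace.re ≤ Real.exp v * M.trace.re := by
  have hYi : Integrable Y P := integrable_of_norm_le hY hnorm
  have hei : Integrable (fun ω => NormedSpace.exp (Y ω)) P :=
    integrable_of_norm_le ((continuous_matrix_exp m).measurable.comp hY) (c := Real.exp 1)
      fun ω => (norm_exp_le_of_isHermitian (hherm ω)).trans (Real.exp_le_exp.2 (hnorm ω))
  have hsq : Integrable (fun ω => Y ω * Y ω) P :=
    integrable_of_norm_le ((continuous_id.mul continuous_id).measurable.comp hY) (c := 1)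
      fun ω => (norm_mul_le _ _).trans (mul_le_one₀ (hnorm ω) (norm_nonneg _) (hnorm ω))
  have h0 : 0 ≤ M.trace.re := (Complex.nonneg_iff.1 hM.trace_nonneg).1
  rw [← integral_traceMulRe_left hei]
  have h1 : ∫ ω, (M * NormedSpace.exp (Y ω)).trace.re ∂P ≤
      ∫ ω, (M.trace.re + (M * Y ω).trace.re + (M * (Y ω * Y ω)).trace.re) ∂P := by
    refine integral_mono (integrable_traceMulRe_left hei M)
      (((integrable_const _).add (integrable_traceMulRe_left hYi M)).add
        (integrable_traceMulRe_left hsq M)) fun ω => ?_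
    have := re_trace_mul_nonneg hM (posSemidef_one_add_add_sq_sub_exp (hherm ω) (hnorm ω))
    simp only [mul_sub, mul_add, mul_one, Matrix.trace_sub, Matrix.trace_add, Complex.sub_re,
      Complex.add_re] at this
    simpa using this
  have hci : Integrable (fun ω => M.trace.re + (M * Y ω).trace.re) P :=
    (integrable_const _).add (integrable_traceMulRe_left hYi M)
  rw [integral_add hci (integrable_traceMulRe_left hsq M), integral_add (integrable_const _)
    (integrable_traceMulRe_left hYi M), integral_traceMulRe_left hYi, hmean] at h1
  have h2 := hvar M hM
  have h3 := mul_le_mul_of_nonneg_right (Real.add_one_le_exp v) h0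
  simp at h1
  linarith

/-- Golden–Thompson separates one summand from the rest, independence replaces its exponential by
the mean, and the previous lemma extracts a factor `exp v`. The initial value `m` is the trace of
the identity. -/
theorem integral_trace_exp_sum_le {Y : κ → Ω → Matrix (Fin m) (Fin m) ℂ}
    (hY : ∀ j, Measurable (Y j)) (hindep : iIndepFun Y P)
    (hherm : ∀ j ω, (Y j ω).IsHermitian) (hnorm : ∀ j ω, ‖Y j ω‖ ≤ 1)
    (hmean : ∀ j, ∫ ω, Y j ω ∂P = 0) {v : ℝ}
    (hvar : ∀ j, ∀ M : Matrix (Fin m) (Fin m) ℂ, M.PosSemidef →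
      ∫ ω, (M * (Y j ω * Y j ω)).trace.re ∂P ≤ v * M.trace.re) (s : Finset κ) :
    Integrable (fun ω => NormedSpace.exp (∑ j ∈ s, Y j ω)) P ∧
    ∫ ω, (NormedSpace.exp (∑ j ∈ s, Y j ω)).trace.re ∂P ≤ m * Real.exp v ^ s.card := by
  classical
  have hsherm : ∀ (s : Finset κ) ω, (∑ j ∈ s, Y j ω).IsHermitian := fun s ω => by
    rw [Matrix.IsHermitian, Matrix.conjTranspose_sum]
    exact Finset.sum_congr rfl fun j _ => hherm j ω
  have hint : ∀ s : Finset κ, Integrable (fun ω => NormedSpace.exp (∑ j ∈ s, Y j ω)) P := by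
    intro s
    refine integrable_of_norm_le ((continuous_matrix_exp m).measurable.comp
      (Finset.measurable_fun_sum s fun j _ => hY j)) (c := Real.exp s.card) fun ω => ?_
    refine (norm_exp_le_of_isHermitian (hsherm s ω)).trans (Real.exp_le_exp.2 ?_)
    refine (norm_sum_le _ _).trans ((Finset.sum_le_sum fun j _ => hnorm j ω).trans ?_)
    simp
  refine ⟨hint s, ?_⟩
  induction s using Finset.induction_on with
  | empty => simp [NormedSpace.exp_zero]
  | insert j s hj ih =>
    have hei : Integrable (fun ω => NormedSpace.exp (Y j ω)) P := by
      simpa using hint {j}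
    have hI : IndepFun (fun ω => NormedSpace.exp (∑ i ∈ s, Y i ω))
        (fun ω => NormedSpace.exp (Y j ω)) P := by
      have h := (hindep.indepFun_finsetSum_of_notMem hY hj).comp
        (continuous_matrix_exp m).measurable (continuous_matrix_exp m).measurable
      convert h using 1
      · funext ω
        simp
      · rfl
    have h1 : ∫ ω, (NormedSpace.exp (∑ i ∈ insert j s, Y i ω)).trace.re ∂P ≤
        ∫ ω, traceMulRe (Fin m) (NormedSpace.exp (∑ i ∈ s, Y i ω))
          (NormedSpace.exp (Y j ω)) ∂P := by
      refine integral_mono ?_ (hI.integrable_bilin (hint s) hei _) fun ω => ?_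
      · simpa using integrable_traceMulRe_left (hint (insert j s)) 1
      · rw [Finset.sum_insert hj, add_comm]
        exact trace_exp_add_le (hsherm s ω) (hherm j ω)
    rw [hI.integral_bilin (hint s) hei (traceMulRe (Fin m))] at h1
    have h2 : traceMulRe (Fin m) (∫ ω, NormedSpace.exp (∑ i ∈ s, Y i ω) ∂P)
        (∫ ω, NormedSpace.exp (Y j ω) ∂P) =
        ∫ ω, (NormedSpace.exp (∑ i ∈ s, Y i ω) * ∫ ω', NormedSpace.exp (Y j ω') ∂P).trace.re ∂P :=
      (((traceMulRe (Fin m)).flip (∫ ω, NormedSpace.exp (Y j ω) ∂P)).integral_comp_comm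
        (hint s)).symm
    rw [h2] at h1
    refine h1.trans ?_
    have h3 : ∫ ω, (NormedSpace.exp (∑ i ∈ s, Y i ω) *
        ∫ ω', NormedSpace.exp (Y j ω') ∂P).trace.re ∂P ≤
        ∫ ω, Real.exp v * (NormedSpace.exp (∑ i ∈ s, Y i ω)).trace.re ∂P := by
      refine integral_mono (((traceMulRe (Fin m)).flip _).integrable_comp (hint s)) ?_ fun ω => ?_
      · simpa using (integrable_traceMulRe_left (hint s) 1).const_mul (Real.exp v)
      · exact integral_trace_mul_exp_le (hY j) (hherm j) (hnorm j) (hmean j) (hvar j)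
          (posSemidef_exp (hsherm s ω))
    refine h3.trans ?_
    rw [integral_const_mul, Finset.card_insert_of_notMem hj, pow_succ]
    have := mul_le_mul_of_nonneg_left ih (Real.exp_nonneg v)
    linarith

/-- A matrix Bernstein inequality, before optimisation of the exponential parameter. -/
theorem measureReal_le_norm_sum_le [Fintype κ] [NeZero m] {Z : κ → Ω → Matrix (Fin m) (Fin m) ℂ}
    (hZ : ∀ j, Measurable (Z j)) (hindep : iIndepFun Z P)
    (hherm : ∀ j ω, (Z j ω).IsHermitian) {U : ℝ} (hnorm : ∀ j ω, ‖Z j ω‖ ≤ U)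
    (hmean : ∀ j, ∫ ω, Z j ω ∂P = 0) {v : ℝ}
    (hvar : ∀ j, ∀ M : Matrix (Fin m) (Fin m) ℂ, M.PosSemidef →
      ∫ ω, (M * (Z j ω * Z j ω)).trace.re ∂P ≤ v * M.trace.re)
    {θ : ℝ} (hθ : 0 < θ) (hU : θ * U ≤ 1) (s : ℝ) :
    P.real {ω | s ≤ ‖∑ j, Z j ω‖} ≤
      2 * m * Real.exp (-(θ * s) + Fintype.card κ * (θ ^ 2 * v)) := by
  have key : ∀ c : ℝ, |c| = θ →
      Integrable (fun ω => NormedSpace.exp (c • ∑ j, Z j ω)) P ∧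
      ∫ ω, (NormedSpace.exp (c • ∑ j, Z j ω)).trace.re ∂P ≤
        m * Real.exp (θ ^ 2 * v) ^ Fintype.card κ := by
    intro c hc
    have h := integral_trace_exp_sum_le (P := P) (Y := fun j ω => c • Z j ω)
      (fun j => (hZ j).const_smul c)
      (hindep.comp (fun _ M => c • M) fun _ => measurable_const_smul c)
      (fun j ω => by rw [Matrix.IsHermitian, Matrix.conjTranspose_smul, (hherm j ω).eq, star_trivial])
      (fun j ω => by
        rw [norm_smul, Real.norm_eq_abs, hc]
        exact (mul_le_mul_of_nonneg_left (hnorm j ω) hθ.le).trans hU)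
      (fun j => by rw [integral_smul, hmean j, smul_zero]) (v := θ ^ 2 * v)
      (fun j M hM => by
        have h2 : ∀ ω, (M * (c • Z j ω * c • Z j ω)).trace.re =
            θ ^ 2 * (M * (Z j ω * Z j ω)).trace.re := fun ω => by
          rw [← hc, sq_abs, smul_mul_smul_comm, mul_smul_comm, Matrix.trace_smul,
            Complex.smul_re, smul_eq_mul, pow_two]
        simp_rw [h2]
        rw [integral_const_mul, mul_assoc]
        exact mul_le_mul_of_nonneg_left (hvar j M hM) (by positivity)) Finset.univ
    simpa only [← Finset.smul_sum, Finset.card_univ] using h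
  obtain ⟨i1, b1⟩ := key θ (abs_of_pos hθ)
  obtain ⟨i2, b2⟩ := key (-θ) (by rw [abs_neg, abs_of_pos hθ])
  have hsherm : ∀ (c : ℝ) ω, (c • ∑ j, Z j ω).IsHermitian := fun c ω => by
    rw [Matrix.IsHermitian, Matrix.conjTranspose_smul, Matrix.conjTranspose_sum, star_trivial]
    congr 1
    exact Finset.sum_congr rfl fun j _ => hherm j ω
  set f : Ω → ℝ := fun ω => (NormedSpace.exp (θ • ∑ j, Z j ω)).trace.re +
    (NormedSpace.exp ((-θ) • ∑ j, Z j ω)).trace.re with hf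
  have j1 : Integrable (fun ω => (NormedSpace.exp (θ • ∑ j, Z j ω)).trace.re) P := by
    simpa using integrable_traceMulRe_left i1 1
  have j2 : Integrable (fun ω => (NormedSpace.exp ((-θ) • ∑ j, Z j ω)).trace.re) P := by
    simpa using integrable_traceMulRe_left i2 1
  have hpos : ∀ c ω, 0 ≤ (NormedSpace.exp ((c : ℝ) • ∑ j, Z j ω)).trace.re := fun c ω =>
    (Complex.nonneg_iff.1 (posSemidef_exp (hsherm c ω)).trace_nonneg).1
  have hmarkov := mul_meas_ge_le_integral_of_nonneg (μ := P) (f := f)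
    (Filter.Eventually.of_forall fun ω => add_nonneg (hpos _ ω) (hpos _ ω)) (j1.add j2)
    (Real.exp (θ * s))
  have hsub : P.real {ω | s ≤ ‖∑ j, Z j ω‖} ≤ P.real {ω | Real.exp (θ * s) ≤ f ω} := by
    refine measureReal_mono fun ω hω => ?_
    have hω' : s ≤ ‖∑ j, Z j ω‖ := hω
    have h := exp_norm_le_trace_exp_add (hsherm θ ω)
    rw [norm_smul, Real.norm_eq_abs, abs_of_pos hθ, ← neg_smul] at h
    exact (Real.exp_le_exp.2 (mul_le_mul_of_nonneg_left hω' hθ.le)).trans h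
  have hint : ∫ ω, f ω ∂P ≤ 2 * m * Real.exp (Fintype.card κ * (θ ^ 2 * v)) := by
    rw [hf, integral_add j1 j2, Real.exp_nat_mul]
    linarith
  rw [Real.exp_add, Real.exp_neg]
  have hpe := Real.exp_pos (θ * s)
  have h3 := (mul_le_mul_of_nonneg_left hsub hpe.le).trans (hmarkov.trans hint)
  calc P.real {ω | s ≤ ‖∑ j, Z j ω‖}
      = (Real.exp (θ * s))⁻¹ * (Real.exp (θ * s) * P.real {ω | s ≤ ‖∑ j, Z j ω‖}) := by
        field_simp
    _ ≤ (Real.exp (θ * s))⁻¹ * (2 * m * Real.exp (Fintype.card κ * (θ ^ 2 * v))) :=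
        mul_le_mul_of_nonneg_left h3 (by positivity)
    _ = _ := by ring

/-- The matrix Bernstein inequality. -/
theorem measureReal_bernstein_le [Fintype κ] [NeZero m] {Z : κ → Ω → Matrix (Fin m) (Fin m) ℂ}
    (hZ : ∀ j, Measurable (Z j)) (hindep : iIndepFun Z P)
    (hherm : ∀ j ω, (Z j ω).IsHermitian) {U : ℝ} (hnorm : ∀ j ω, ‖Z j ω‖ ≤ U)
    (hmean : ∀ j, ∫ ω, Z j ω ∂P = 0) {v : ℝ}
    (hvar : ∀ j, ∀ M : Matrix (Fin m) (Fin m) ℂ, M.PosSemidef →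
      ∫ ω, (M * (Z j ω * Z j ω)).trace.re ∂P ≤ v * M.trace.re)
    (hU : 0 < U) (hv : 0 ≤ v) {r : ℝ} (hr : 0 < r) :
    P.real {ω | 2 * r * U + 2 * √(Fintype.card κ * v * r) ≤ ‖∑ j, Z j ω‖} ≤
      2 * m * Real.exp (-r) := by
  set q := √(Fintype.card κ * v * r) with hq
  have hq0 : 0 ≤ q := Real.sqrt_nonneg _
  have hq2 : q ^ 2 = Fintype.card κ * v * r := Real.sq_sqrt (by positivity)
  have hden : 0 < r * U + q := by positivity
  -- For this `θ` the linear part of the exponent is exactly `-2 r`, while the variance part is `r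
  -- (q / (r U + q))² ≤ r`.
  have h := measureReal_le_norm_sum_le hZ hindep hherm hnorm hmean hvar
    (θ := r / (r * U + q)) (by positivity)
    (by rw [div_mul_eq_mul_div, div_le_one hden]; linarith) (2 * r * U + 2 * q)
  refine h.trans ?_
  refine mul_le_mul_of_nonneg_left (Real.exp_le_exp.2 ?_) (by positivity)
  have e1 : r / (r * U + q) * (2 * r * U + 2 * q) = 2 * r := by field_simp
  have e2 : Fintype.card κ * ((r / (r * U + q)) ^ 2 * v) = r * (q / (r * U + q)) ^ 2 := by
    rw [div_pow, div_pow, hq2]; field_simp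
  have e3 : (q / (r * U + q)) ^ 2 ≤ 1 :=
    pow_le_one₀ (by positivity) ((div_le_one hden).2 (le_add_of_nonneg_left (by positivity)))
  rw [e1, e2]
  nlinarith

end Bernstein

end MatrixFunctionEstimation

namespace MatrixFunctionEstimation

/-! ### Bias of kernel smoothing for scalar Hölder functions -/

section Bias

/-- The derivative of the Taylor remainder is the remainder of one order less for the shifted
sequence `g (· + 1)`, so the mean value inequality on the segment from `t` to `x` adds one factor
`|x - t|`. The factor `1 / ℓ!` is given up. -/
theorem abs_sub_taylor_le {L γ : ℝ} (hL : 0 ≤ L) (hγ : 0 ≤ γ) (ℓ : ℕ) {g : ℕ → ℝ → ℝ}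
    (hg : ∀ k < ℓ, ∀ x ∈ Icc (0 : ℝ) 1, HasDerivWithinAt (g k) (g (k + 1) x) (Icc 0 1) x)
    (hH : ∀ x ∈ Icc (0 : ℝ) 1, ∀ y ∈ Icc (0 : ℝ) 1, |g ℓ x - g ℓ y| ≤ L * |x - y| ^ γ)
    {t x : ℝ} (ht : t ∈ Icc (0 : ℝ) 1) (hx : x ∈ Icc (0 : ℝ) 1) :
    |g 0 x - ∑ k ∈ Finset.range (ℓ + 1), g k t / k.factorial * (x - t) ^ k| ≤
      L * |x - t| ^ γ * |x - t| ^ ℓ := by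
  induction ℓ generalizing g x with
  | zero => simpa using hH x hx t ht
  | succ ℓ ih =>
    have hsub : uIcc t x ⊆ Icc (0 : ℝ) 1 := uIcc_subset_Icc ht hx
    have hbound : ∀ y ∈ uIcc t x, ‖g 1 y - ∑ k ∈ Finset.range (ℓ + 1),
        g (k + 1) t / k.factorial * (y - t) ^ k‖ ≤ L * |x - t| ^ γ * |x - t| ^ ℓ := by
      intro y hy
      have h := ih (g := fun k => g (k + 1)) (fun k hk => hg (k + 1) (by omega)) hH (hsub hy)
      have hyx : |y - t| ≤ |x - t| := abs_sub_left_of_mem_uIcc hy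
      refine (Real.norm_eq_abs _).trans_le (h.trans ?_)
      gcongr
    have hder : ∀ y ∈ uIcc t x, HasDerivWithinAt
        (fun y => g 0 y - ∑ k ∈ Finset.range (ℓ + 2), g k t / k.factorial * (y - t) ^ k)
        (g 1 y - ∑ k ∈ Finset.range (ℓ + 1), g (k + 1) t / k.factorial * (y - t) ^ k)
        (uIcc t x) y := by
      intro y hy
      refine ((hg 0 (by omega) y (hsub hy)).mono hsub).sub ?_
      have hk : ∀ k ∈ Finset.range (ℓ + 2), HasDerivWithinAt
          (fun y => g k t / k.factorial * (y - t) ^ k)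
          (g k t / k.factorial * (k * (y - t) ^ (k - 1))) (uIcc t x) y := fun k _ => by
        have := ((((hasDerivAt_id y).sub_const t).pow k).const_mul
          (g k t / k.factorial)).hasDerivWithinAt (s := uIcc t x)
        simpa using this
      have hs := HasDerivWithinAt.fun_sum hk
      convert hs using 1
      rw [Finset.sum_range_succ' _ (ℓ + 1)]
      simp only [Nat.cast_zero, zero_mul, mul_zero, add_zero, Nat.add_sub_cancel]
      refine Finset.sum_congr rfl fun k _ => ?_
      rw [Nat.factorial_succ]
      push_cast
      have : (k : ℝ) + 1 ≠ 0 := by positivity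
      field_simp
    have h := (convex_uIcc t x).norm_image_sub_le_of_norm_hasDerivWithin_le hder hbound
      left_mem_uIcc right_mem_uIcc
    have h0 : g 0 t - ∑ k ∈ Finset.range (ℓ + 2), g k t / k.factorial * (t - t) ^ k = 0 := by
      rw [Finset.sum_range_succ']; simp
    rw [h0, sub_zero, Real.norm_eq_abs, Real.norm_eq_abs] at h
    rw [pow_succ, ← mul_assoc]
    exact h

theorem HolderClass.continuousOn {β L : ℝ} {f : ℝ → ℝ} (hβ : 0 < β) (hf : HolderClass β L f) :
    ContinuousOn f (Icc 0 1) := by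
  obtain ⟨h1, h2⟩ := hf
  rcases Nat.eq_zero_or_pos ⌊β⌋₊ with h0 | h0
  · rw [h0] at h2
    simp only [iteratedDerivWithin_zero, Nat.cast_zero, sub_zero] at h2
    intro x hx
    rw [ContinuousWithinAt, tendsto_iff_norm_sub_tendsto_zero]
    have hc : Continuous fun y : ℝ => L * |y - x| ^ β :=
      continuous_const.mul ((continuous_id.sub continuous_const).abs.rpow_const fun _ => .inr hβ.le)
    have hlim := (hc.tendsto x).mono_left (nhdsWithin_le_nhds (s := Icc (0 : ℝ) 1))
    simp only [sub_self, abs_zero, Real.zero_rpow hβ.ne', mul_zero] at hlim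
    refine squeeze_zero' (Filter.Eventually.of_forall fun _ => norm_nonneg _) ?_ hlim
    filter_upwards [self_mem_nhdsWithin] with y hy using h2 y hy x hx
  · simpa using (h1 0 h0).continuousOn

theorem HolderClass.exists_abs_sub_polynomial_le {β L : ℝ} {f : ℝ → ℝ} (hβ : 0 < β) (hL : 0 ≤ L)
    (hf : HolderClass β L f) {t : ℝ} (ht : t ∈ Icc (0 : ℝ) 1) :
    ∃ c : ℕ → ℝ, c 0 = f t ∧ ∀ x ∈ Icc (0 : ℝ) 1,
      |f x - ∑ k ∈ Finset.range (⌊β⌋₊ + 1), c k * (x - t) ^ k| ≤ L * |x - t| ^ β := by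
  have hfl : (⌊β⌋₊ : ℝ) ≤ β := Nat.floor_le hβ.le
  refine ⟨fun k => iteratedDerivWithin k f (Icc 0 1) t / k.factorial, by simp, fun x hx => ?_⟩
  have h := abs_sub_taylor_le hL (sub_nonneg.2 hfl) ⌊β⌋₊
    (g := fun k => iteratedDerivWithin k f (Icc 0 1)) (fun k hk x hx => by
      have := (hf.1 k hk x hx).hasDerivWithinAt
      rwa [← iteratedDerivWithin_succ] at this) hf.2 ht hx
  simp only [iteratedDerivWithin_zero] at h
  refine h.trans (le_of_eq ?_)
  -- Exponents add only for a nonzero base. At `x = t` both sides vanish, since either `⌊β⌋₊ = 0`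
  -- and `β > 0`, or the natural power is zero.
  rcases eq_or_ne (|x - t|) 0 with h0 | h0
  · rw [h0, Real.zero_rpow hβ.ne']
    rcases Nat.eq_zero_or_pos ⌊β⌋₊ with h1 | h1
    · rw [h1]; simp [Real.zero_rpow hβ.ne']
    · rw [zero_pow h1.ne']; simp
  · rw [mul_assoc, ← Real.rpow_natCast, ← Real.rpow_add ((abs_nonneg _).lt_of_ne' h0)]
    simp

theorem kernel_eq_zero {K : ℝ → ℝ} {ℓ : ℕ} (hK : IsAdmissibleKernel K ℓ) {u : ℝ}
    (hu : u ∉ Icc (-1 : ℝ) 1) : K u = 0 := by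
  by_contra h
  exact hu (hK.support_subset h)

/-- `K` vanishes at `2`, which is within distance `3` of every point of the support. -/
theorem abs_kernel_le {K : ℝ → ℝ} {ℓ : ℕ} (hK : IsAdmissibleKernel K ℓ) {LK : NNReal}
    (hLK : LipschitzWith LK K) (u : ℝ) : |K u| ≤ 3 * LK := by
  by_cases hu : u ∈ Icc (-1 : ℝ) 1
  · have h := hLK.dist_le_mul u 2
    rw [kernel_eq_zero hK (u := 2) (by norm_num), Real.dist_eq, Real.dist_eq, sub_zero] at h
    have h2 : |u - 2| ≤ 3 := abs_le.2 ⟨by linarith [hu.1], by linarith [hu.2]⟩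
    nlinarith [LK.coe_nonneg]
  · rw [kernel_eq_zero hK hu, abs_zero]; positivity

/-- After the substitution `s = t + h u` the Taylor polynomial integrates to `f t` by the moment
conditions; the remainder is at most `M L h ^ β` on an interval of length `2`. -/
theorem abs_kernel_smoothing_sub_le {K : ℝ → ℝ} {ℓ : ℕ} (hK : IsAdmissibleKernel K ℓ) {M : ℝ}
    (hM : ∀ u, |K u| ≤ M) {β L : ℝ} {f : ℝ → ℝ} (hβ : 0 < β) (hℓ : ⌊β⌋₊ = ℓ) (hL : 0 ≤ L)
    (hf : HolderClass β L f) {h t : ℝ} (hh : 0 < h) (ht : t ∈ Icc h (1 - h)) :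
    |(∫ s in Icc (0 : ℝ) 1, K ((s - t) / h) * f s) - h * f t| ≤ h * (2 * M * L * h ^ β) := by
  obtain ⟨LK, -, hLK⟩ := hK.lipschitz
  have ht1 : t ∈ Icc (0 : ℝ) 1 := ⟨by linarith [ht.1], by linarith [ht.2]⟩
  -- Since `t ∈ [h, 1 - h]`, the whole kernel window lies in `[0, 1]`: no mass of `K` is lost at the
  -- boundary.
  have hmem : ∀ u ∈ Icc (-1 : ℝ) 1, t + h * u ∈ Icc (0 : ℝ) 1 := fun u hu =>
    ⟨by nlinarith [hu.1, ht.1], by nlinarith [hu.2, ht.2]⟩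
  have hcv : ∫ s in Icc (0 : ℝ) 1, K ((s - t) / h) * f s = h * ∫ u, K u * f (t + h * u) := by
    rw [setIntegral_eq_integral_of_forall_compl_eq_zero]
    · have e : ∀ s, K ((s - t) / h) * f s =
          (fun u => K (u / h) * f (t + h * (u / h))) (s - t) := fun s => by
        simp only; rw [mul_div_cancel₀ _ hh.ne', add_sub_cancel]
      simp_rw [e]
      rw [integral_sub_right_eq_self (fun u => K (u / h) * f (t + h * (u / h)))]
      rw [Measure.integral_comp_div (fun u => K u * f (t + h * u)) h, abs_of_pos hh, smul_eq_mul]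
    · intro s hs
      rw [kernel_eq_zero hK, zero_mul]
      intro hu
      have := hmem _ hu
      rw [mul_div_cancel₀ _ hh.ne', add_sub_cancel] at this
      exact hs this
  obtain ⟨c, hc0, hc⟩ := hf.exists_abs_sub_polynomial_le hβ hL ht1
  rw [hℓ] at hc
  set p : ℝ → ℝ := fun u => ∑ k ∈ Finset.range (ℓ + 1), c k * (h * u) ^ k with hp
  have hKf : Integrable fun u => K u * f (t + h * u) := by
    have hcont : ContinuousOn (fun u => K u * f (t + h * u)) (Icc (-1) 1) :=
      hLK.continuous.continuousOn.mul
        ((hf.continuousOn hβ).comp (by fun_prop) fun u hu => hmem u hu)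
    refine hcont.integrableOn_Icc.integrable_of_forall_notMem_eq_zero fun u hu => ?_
    rw [kernel_eq_zero hK hu, zero_mul]
  have hterm : ∀ k ∈ Finset.range (ℓ + 1), Integrable fun u => c k * h ^ k * (u ^ k * K u) :=
    fun k hk => (hK.order.integrable_moment k (by simpa [Nat.lt_succ_iff] using hk)).const_mul _
  have hpe : ∀ u, K u * p u = ∑ k ∈ Finset.range (ℓ + 1), c k * h ^ k * (u ^ k * K u) := fun u => by
    rw [hp, Finset.mul_sum]
    refine Finset.sum_congr rfl fun k _ => by ring
  have hKp : Integrable fun u => K u * p u := by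
    simp_rw [hpe]; exact integrable_finsetSum _ hterm
  have hKp1 : ∫ u, K u * p u = f t := by
    simp_rw [hpe]
    rw [integral_finsetSum _ hterm, Finset.sum_eq_single 0]
    · rw [integral_const_mul]; simp [hK.order.integral_eq_one, hc0]
    · intro k hk h0
      rw [integral_const_mul, hK.order.moment_eq_zero k (Nat.one_le_iff_ne_zero.2 h0)
        (by simpa [Nat.lt_succ_iff] using hk), mul_zero]
    · simp
  rw [hcv, ← mul_sub, abs_mul, abs_of_pos hh, ← hKp1, ← integral_sub hKf hKp]
  refine mul_le_mul_of_nonneg_left ?_ hh.le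
  rw [← setIntegral_eq_integral_of_forall_compl_eq_zero (s := Icc (-1) 1)
    (fun u hu => by rw [kernel_eq_zero hK hu]; ring)]
  have hM0 : 0 ≤ M := (abs_nonneg _).trans (hM 0)
  have hb := norm_setIntegral_le_of_norm_le_const (μ := volume) (s := Icc (-1 : ℝ) 1)
    (f := fun u => K u * f (t + h * u) - K u * p u) (C := M * (L * h ^ β)) (by simp)
    (fun u hu => by
      rw [← mul_sub, Real.norm_eq_abs, abs_mul]
      have h1 := hc _ (hmem u hu)
      rw [add_sub_cancel_left] at h1
      refine mul_le_mul (hM u) (h1.trans ?_) (abs_nonneg _) hM0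
      gcongr
      rw [abs_mul, abs_of_pos hh]
      have : |u| ≤ 1 := abs_le.2 hu
      nlinarith)
  rw [Real.norm_eq_abs] at hb
  refine hb.trans (le_of_eq ?_)
  simp
  ring

end Bias

end MatrixFunctionEstimation

namespace MatrixFunctionEstimation

open scoped Matrix Matrix.Norms.L2Operator ComplexOrder

/-! ### The orthonormal basis and the uniform law on it -/

section SamplingSet

variable {m : ℕ}

theorem ofReal_inv_sqrt_two_mul_self :
    ((1 / Real.sqrt 2 : ℝ) : ℂ) * ((1 / Real.sqrt 2 : ℝ) : ℂ) = 1 / 2 := by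
  rw [← Complex.ofReal_mul, div_mul_div_comm, Real.mul_self_sqrt (by norm_num)]
  push_cast; norm_num

theorem isHermitian_basisMatrix (k j : Fin m) : (basisMatrix m k j).IsHermitian := by
  unfold basisMatrix Matrix.IsHermitian
  split_ifs with h1 h2
  · simp
  · simp [Matrix.conjTranspose_add, add_comm]
  · rw [Matrix.conjTranspose_smul, Matrix.conjTranspose_sub, Matrix.conjTranspose_single,
      Matrix.conjTranspose_single, star_one, star_mul', RCLike.star_def,
      Complex.conj_I, Complex.conj_ofReal, neg_mul, neg_smul, ← smul_neg, neg_sub]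

theorem basisMatrix_mul_self (k j : Fin m) :
    basisMatrix m k j * basisMatrix m k j =
      (1 / 2 : ℂ) • (Matrix.single k k 1 + Matrix.single j j 1) := by
  unfold basisMatrix
  split_ifs with h1 h2
  · subst h1
    rw [Matrix.single_mul_single_same, ← two_smul ℂ, smul_smul]
    norm_num
  · have h3 : k ≠ j := h1
    rw [smul_mul_smul_comm, ofReal_inv_sqrt_two_mul_self]
    congr 1
    simp only [add_mul, mul_add, Matrix.single_mul_single_same,
      Matrix.single_mul_single_of_ne _ _ _ _ h3, Matrix.single_mul_single_of_ne _ _ _ _ h3.symm]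
    simp [add_comm]
  · have h3 : k ≠ j := h1
    have e : Complex.I * ((1 / Real.sqrt 2 : ℝ) : ℂ) * (Complex.I * ((1 / Real.sqrt 2 : ℝ) : ℂ)) =
        -(1 / 2) := by
      rw [mul_mul_mul_comm, ofReal_inv_sqrt_two_mul_self, Complex.I_mul_I]; ring
    rw [smul_mul_smul_comm, e, neg_smul, ← smul_neg]
    congr 1
    simp only [sub_mul, mul_sub, Matrix.single_mul_single_same,
      Matrix.single_mul_single_of_ne _ _ _ _ h3, Matrix.single_mul_single_of_ne _ _ _ _ h3.symm]
    simp

theorem norm_basisMatrix_le (k j : Fin m) : ‖basisMatrix m k j‖ ≤ 1 := by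
  have h := Matrix.l2_opNorm_conjTranspose_mul_self (basisMatrix m k j)
  rw [(isHermitian_basisMatrix k j).eq, basisMatrix_mul_self] at h
  have h1 : ∀ i : Fin m, ‖(Matrix.single i i 1 : Matrix (Fin m) (Fin m) ℂ)‖ ≤ 1 := fun i => by
    rw [← Matrix.diagonal_single, Matrix.l2_opNorm_diagonal]
    refine (pi_norm_le_iff_of_nonneg zero_le_one).2 fun l => ?_
    rw [Pi.single_apply]; split_ifs <;> simp
  have h2 : ‖(1 / 2 : ℂ) • ((Matrix.single k k 1 : Matrix (Fin m) (Fin m) ℂ) +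
      Matrix.single j j 1)‖ ≤ 1 := by
    rw [norm_smul]
    have := norm_add_le (Matrix.single k k 1 : Matrix (Fin m) (Fin m) ℂ) (Matrix.single j j 1)
    have e : ‖(1 / 2 : ℂ)‖ = 1 / 2 := by norm_num
    rw [e]
    linarith [h1 k, h1 j]
  nlinarith [norm_nonneg (basisMatrix m k j)]

theorem sum_single_self : ∑ k : Fin m, (Matrix.single k k 1 : Matrix (Fin m) (Fin m) ℂ) = 1 := by
  simp only [← Matrix.diagonal_single, ← Matrix.diagonal_one]
  ext a b
  rw [Matrix.sum_apply]
  by_cases h : a = b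
  · subst h; simp [Pi.single_apply]
  · simp [h]

/-- Each square is `(e_kk + e_jj) / 2`. Averaged over the `m²` elements this gives `E X² = I / m`,
the source of the factor `1 / m` in the variance. -/
theorem sum_basisMatrix_mul_self :
    ∑ p : Fin m × Fin m, basisMatrix m p.1 p.2 * basisMatrix m p.1 p.2 = (m : ℂ) • 1 := by
  simp only [basisMatrix_mul_self, ← Finset.smul_sum, Fintype.sum_prod_type,
    Finset.sum_add_distrib, sum_single_self, Finset.sum_const, Finset.card_univ, Fintype.card_fin]
  rw [← Nat.cast_smul_eq_nsmul ℂ, ← two_smul ℂ, smul_smul]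
  norm_num

theorem basisMatrix_apply_eq_zero {k j a b : Fin m} (h1 : ¬(k = a ∧ j = b)) (h2 : ¬(j = a ∧ k = b)) :
    basisMatrix m k j a b = 0 := by
  unfold basisMatrix
  split_ifs with h
  · subst h; exact Matrix.single_apply_of_ne _ _ _ _ _ h1
  · simp [h1, h2]
  · simp [h1, h2]

theorem hsInner_basisMatrix {B : Matrix (Fin m) (Fin m) ℂ} (hB : B.IsHermitian) (k j : Fin m) :
    hsInner B (basisMatrix m k j) = if k = j then (B k k).re else
      if j < k then 2 * (1 / Real.sqrt 2) * (B j k).re else 2 * (1 / Real.sqrt 2) * (B k j).im := by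
  have hs : B j k = star (B k j) := (hB.apply j k).symm
  unfold hsInner basisMatrix
  generalize 1 / Real.sqrt 2 = r
  split_ifs with h1 h2
  · simp [Matrix.trace_mul_single]
  · simp only [mul_smul_comm, Matrix.trace_smul, mul_add, Matrix.trace_add,
      Matrix.trace_mul_single, hs, smul_eq_mul]
    simp; ring
  · simp only [mul_smul_comm, Matrix.trace_smul, mul_sub, Matrix.trace_sub,
      Matrix.trace_mul_single, hs, smul_eq_mul]
    simp; ring

/-- The expansion of a Hermitian matrix in the orthonormal basis `𝒳`. -/
theorem sum_hsInner_smul_basisMatrix {B : Matrix (Fin m) (Fin m) ℂ} (hB : B.IsHermitian) :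
    ∑ p : Fin m × Fin m, hsInner B (basisMatrix m p.1 p.2) • basisMatrix m p.1 p.2 = B := by
  have hr : (1 / Real.sqrt 2) * (1 / Real.sqrt 2) = 1 / 2 := by
    rw [div_mul_div_comm, Real.mul_self_sqrt (by norm_num)]; norm_num
  ext a b
  rw [Matrix.sum_apply]
  rcases eq_or_ne a b with rfl | hab
  · rw [Finset.sum_eq_single (a, a)]
    · simp only [Matrix.smul_apply, hsInner_basisMatrix hB, if_true]
      have := hB.coe_re_apply_self a
      simpa [basisMatrix] using this
    · rintro ⟨k, j⟩ - hp
      rw [Matrix.smul_apply, basisMatrix_apply_eq_zero, smul_zero]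
      · exact fun h => hp (Prod.ext h.1 h.2)
      · exact fun h => hp (Prod.ext h.2 h.1)
    · simp
  · have hne : (a, b) ≠ (b, a) := fun h => hab (Prod.mk.inj h).1
    rw [← Finset.sum_subset (Finset.subset_univ {(a, b), (b, a)}), Finset.sum_pair hne]
    · have hs : B b a = star (B a b) := (hB.apply b a).symm
      simp only [Matrix.smul_apply, hsInner_basisMatrix hB, if_neg hab, if_neg hab.symm]
      rcases lt_or_gt_of_ne hab with h | h
      · simp only [if_neg h.not_gt, if_pos h, basisMatrix, if_neg hab, if_neg hab.symm]
        generalize 1 / Real.sqrt 2 = r at hr ⊢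
        refine Complex.ext ?_ ?_ <;> simp [hab]
        · linear_combination 2 * (B a b).re * hr
        · linear_combination 2 * (B a b).im * hr
      · simp only [if_neg h.not_gt, if_pos h, basisMatrix, if_neg hab, if_neg hab.symm]
        generalize 1 / Real.sqrt 2 = r at hr ⊢
        refine Complex.ext ?_ ?_ <;> simp [hab, hs]
        · linear_combination 2 * (B a b).re * hr
        · linear_combination 2 * (B a b).im * hr
    · rintro ⟨k, j⟩ - hp
      rw [Matrix.smul_apply, basisMatrix_apply_eq_zero, smul_zero]
      · exact fun h => hp (Finset.mem_insert.2 (.inl (Prod.ext h.1 h.2)))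
      · exact fun h => hp (Finset.mem_insert_of_mem (Finset.mem_singleton.2 (Prod.ext h.2 h.1)))

theorem basisMatrix_apply_ne_zero (k j : Fin m) : basisMatrix m k j k j ≠ 0 := by
  unfold basisMatrix
  split_ifs with h1 h2
  · subst h1; simp
  · have h3 : k ≠ j := h1
    simp [h3]
  · have h3 : k ≠ j := h1
    simp [h3]

theorem basisMatrix_swap_ne {k j : Fin m} (h : j < k) : basisMatrix m k j ≠ basisMatrix m j k := by
  intro e
  have h1 := congrArg Complex.re (congrFun (congrFun e k) j)
  simp [basisMatrix, h.ne, h.ne', h, h.not_gt] at h1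

/-- The `(k, j)` entry of the matrix is nonzero, so an equal matrix has index `(k, j)` or `(j, k)`;
the swapped one differs by being imaginary instead of real. Hence the uniform law on `𝒳` gives mass
`m⁻²` to each index pair. -/
theorem basisMatrix_injective :
    Function.Injective fun p : Fin m × Fin m => basisMatrix m p.1 p.2 := by
  rintro ⟨k, j⟩ ⟨k', j'⟩ h
  have h : basisMatrix m k j = basisMatrix m k' j' := h
  have h0 := basisMatrix_apply_ne_zero k j
  rw [h] at h0
  by_contra hne
  have h1 : ¬(k' = k ∧ j' = j) := fun e => hne (by rw [e.1, e.2])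
  by_cases h2 : j' = k ∧ k' = j
  · obtain ⟨rfl, rfl⟩ := h2
    rcases lt_trichotomy j' k' with h3 | h3 | h3
    · exact basisMatrix_swap_ne h3 h.symm
    · exact h1 ⟨h3.symm, h3⟩
    · exact basisMatrix_swap_ne h3 h
  · exact h0 (basisMatrix_apply_eq_zero h1 h2)

open scoped Classical in
theorem samplingSet_eq_coe_image : samplingSet m =
    ((Finset.univ : Finset (Fin m × Fin m)).image fun p => basisMatrix m p.1 p.2 : Finset _) := by
  ext E
  simp [samplingSet, eq_comm]

theorem measurableSet_samplingSet : MeasurableSet (samplingSet m) := by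
  classical
  rw [samplingSet_eq_coe_image]
  exact Finset.measurableSet _

theorem uniformOn_samplingSet : uniformOn (samplingSet m) =
    ((m : ENNReal) ^ 2)⁻¹ • ∑ p : Fin m × Fin m, Measure.dirac (basisMatrix m p.1 p.2) := by
  classical
  ext s hs
  rw [uniformOn, cond_apply measurableSet_samplingSet, Measure.smul_apply, smul_eq_mul,
    samplingSet_eq_coe_image, Measure.count_apply_finset,
    Finset.card_image_of_injective _ basisMatrix_injective, Measure.finsetSum_apply]
  congr 1
  · simp [pow_two]
  · have e : (((Finset.univ : Finset (Fin m × Fin m)).image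
        fun p => basisMatrix m p.1 p.2 : Finset _) : Set (Matrix (Fin m) (Fin m) ℂ)) ∩ s =
        (((Finset.univ : Finset (Fin m × Fin m)).filter
          fun p => basisMatrix m p.1 p.2 ∈ s).image fun p => basisMatrix m p.1 p.2 : Finset _) := by
      ext E
      simp only [Finset.coe_image, Finset.coe_univ, image_univ, mem_inter_iff, mem_range,
        Finset.coe_filter, Finset.mem_univ, true_and, mem_image, mem_ofPred_eq]
      constructor
      · rintro ⟨⟨p, rfl⟩, hp⟩; exact ⟨p, hp, rfl⟩
      · rintro ⟨p, hp, rfl⟩; exact ⟨⟨p, rfl⟩, hp⟩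
    rw [e, Measure.count_apply_finset, Finset.card_image_of_injective _ basisMatrix_injective,
      Finset.card_filter]
    push_cast
    refine Finset.sum_congr rfl fun p _ => ?_
    rw [Measure.dirac_apply' _ hs, indicator_apply]
    simp

theorem integral_uniformOn_samplingSet {F : Type*} [NormedAddCommGroup F] [NormedSpace ℝ F]
    [CompleteSpace F] (f : Matrix (Fin m) (Fin m) ℂ → F) :
    ∫ x, f x ∂(uniformOn (samplingSet m)) =
      ((m : ℝ) ^ 2)⁻¹ • ∑ p : Fin m × Fin m, f (basisMatrix m p.1 p.2) := by
  rw [uniformOn_samplingSet, integral_smul_measure, integral_finsetSum_measure]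
  · simp
  · exact fun p _ => integrable_dirac (by simp)

theorem integrable_uniformOn_samplingSet [NeZero m] {F : Type*} [NormedAddCommGroup F]
    (f : Matrix (Fin m) (Fin m) ℂ → F) : Integrable f (uniformOn (samplingSet m)) := by
  rw [uniformOn_samplingSet]
  refine Integrable.smul_measure (integrable_finsetSum_measure.2 fun p _ =>
    integrable_dirac (by simp)) ?_
  simp [NeZero.ne m]

end SamplingSet

end MatrixFunctionEstimation

namespace MatrixFunctionEstimation

open scoped Matrix Matrix.Norms.L2Operator ComplexOrder

/-! ### Mean and second moment of one summand -/

section Summand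

variable {m : ℕ}

open scoped Classical in
/-- A summand of the kernel estimator, set to zero off the almost sure event that the design is in
`𝒳` and the response is bounded by `a`. -/
noncomputable def truncatedTerm (K : ℝ → ℝ) (h a t : ℝ) (p : ℝ × Matrix (Fin m) (Fin m) ℂ × ℝ) :
    Matrix (Fin m) (Fin m) ℂ :=
  if p.2.1 ∈ samplingSet m ∧ |p.2.2| ≤ a then (K ((p.1 - t) / h) * p.2.2) • p.2.1 else 0

theorem isHermitian_real_smul {x : Matrix (Fin m) (Fin m) ℂ} (hx : x.IsHermitian) (c : ℝ) :
    (c • x).IsHermitian := by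
  rw [Matrix.IsHermitian, Matrix.conjTranspose_smul, hx.eq, star_trivial]

theorem isHermitian_of_mem_samplingSet {x : Matrix (Fin m) (Fin m) ℂ} (hx : x ∈ samplingSet m) :
    x.IsHermitian := by
  obtain ⟨k, j, rfl⟩ := hx
  exact isHermitian_basisMatrix k j

theorem norm_le_one_of_mem_samplingSet {x : Matrix (Fin m) (Fin m) ℂ} (hx : x ∈ samplingSet m) :
    ‖x‖ ≤ 1 := by
  obtain ⟨k, j, rfl⟩ := hx
  exact norm_basisMatrix_le k j

theorem measurable_truncatedTerm {K : ℝ → ℝ} (hK : Continuous K) (h a t : ℝ) :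
    Measurable (truncatedTerm (m := m) K h a t) := by
  have hKm := hK.measurable
  have h1 : Measurable fun p : ℝ × Matrix (Fin m) (Fin m) ℂ × ℝ => p.2.1 := measurable_snd.fst
  have h2 : Measurable fun p : ℝ × Matrix (Fin m) (Fin m) ℂ × ℝ => |p.2.2| := by fun_prop
  have h3 : Measurable fun p : ℝ × Matrix (Fin m) (Fin m) ℂ × ℝ => K ((p.1 - t) / h) * p.2.2 := by
    fun_prop
  exact Measurable.ite ((h1 measurableSet_samplingSet).inter (measurableSet_le h2 measurable_const))
    (h3.smul h1) measurable_const

theorem isHermitian_truncatedTerm (K : ℝ → ℝ) (h a t : ℝ) (p : ℝ × Matrix (Fin m) (Fin m) ℂ × ℝ) :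
    (truncatedTerm K h a t p).IsHermitian := by
  unfold truncatedTerm
  split_ifs with hp
  · exact isHermitian_real_smul (isHermitian_of_mem_samplingSet hp.1) _
  · exact Matrix.isHermitian_zero

theorem norm_truncatedTerm_le {K : ℝ → ℝ} {M : ℝ} (hM : ∀ u, |K u| ≤ M) {a : ℝ} (ha : 0 ≤ a)
    (h t : ℝ) (p : ℝ × Matrix (Fin m) (Fin m) ℂ × ℝ) : ‖truncatedTerm K h a t p‖ ≤ M * a := by
  have hM0 : 0 ≤ M := (abs_nonneg _).trans (hM 0)
  unfold truncatedTerm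
  split_ifs with hp
  · rw [norm_smul, Real.norm_eq_abs, abs_mul]
    have h1 := mul_le_mul (hM ((p.1 - t) / h)) hp.2 (abs_nonneg _) hM0
    have h2 := norm_le_one_of_mem_samplingSet hp.1
    exact (mul_le_of_le_one_right (by positivity) h2).trans h1
  · rw [norm_zero]; positivity

theorem norm_truncatedTerm_sub_le {K : ℝ → ℝ} {LK : NNReal} (hK : LipschitzWith LK K) {h a : ℝ}
    (hh : 0 < h) (ha : 0 ≤ a) (t t' : ℝ) (p : ℝ × Matrix (Fin m) (Fin m) ℂ × ℝ) :
    ‖truncatedTerm K h a t p - truncatedTerm K h a t' p‖ ≤ LK * (|t - t'| / h) * a := by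
  unfold truncatedTerm
  split_ifs with hp
  · rw [← sub_smul, norm_smul, Real.norm_eq_abs, ← sub_mul, abs_mul]
    have h1 : |K ((p.1 - t) / h) - K ((p.1 - t') / h)| ≤ LK * (|t - t'| / h) := by
      have := hK.dist_le_mul ((p.1 - t) / h) ((p.1 - t') / h)
      rwa [Real.dist_eq, Real.dist_eq, ← sub_div, sub_sub_sub_cancel_left, abs_div, abs_of_pos hh,
        abs_sub_comm t'] at this
    have h2 := norm_le_one_of_mem_samplingSet hp.1
    exact (mul_le_of_le_one_right (by positivity) h2).trans
      (mul_le_mul h1 hp.2 (abs_nonneg _) (by positivity))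
  · rw [sub_zero, norm_zero]; positivity

theorem isHermitian_integral {α : Type*} [MeasurableSpace α] {μ : Measure α}
    {f : α → Matrix (Fin m) (Fin m) ℂ} (hf : ∀ᵐ x ∂μ, (f x).IsHermitian) (hi : Integrable f μ) :
    (∫ x, f x ∂μ).IsHermitian := by
  have h := (LinearMap.toContinuousLinearMap
    (Matrix.conjTransposeLinearEquiv (Fin m) (Fin m) ℝ ℂ).toLinearMap).integral_comp_comm hi
  rw [Matrix.IsHermitian]
  refine Eq.trans h.symm (integral_congr_ae ?_)
  filter_upwards [hf] with x hx using hx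

theorem HasHolderEntries.continuousOn {β L : ℝ} (hβ : 0 < β) {A : ℝ → Matrix (Fin m) (Fin m) ℂ}
    (hA : HasHolderEntries β L A) : ContinuousOn A (Icc 0 1) := by
  refine continuousOn_pi.2 fun i => continuousOn_pi.2 fun j => ?_
  have h1 := (hA i j).1.continuousOn hβ
  have h2 := (hA i j).2.continuousOn hβ
  have h3 := (Complex.continuous_ofReal.comp_continuousOn h1).add
    ((Complex.continuous_ofReal.comp_continuousOn h2).mul (continuousOn_const (c := Complex.I)))
  exact h3.congr fun t _ => (Complex.re_add_im _).symm

variable {Ω : Type*} [MeasurableSpace Ω] {P : Measure Ω} [IsProbabilityMeasure P]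

/-- The variance equals `E W² - (E W)²`, and the subtracted square is positive semidefinite. -/
theorem integral_trace_mul_centered_sq_le {W : Ω → Matrix (Fin m) (Fin m) ℂ} (hW : Measurable W)
    (hherm : ∀ ω, (W ω).IsHermitian) {c : ℝ} (hnorm : ∀ ω, ‖W ω‖ ≤ c)
    {M : Matrix (Fin m) (Fin m) ℂ} (hM : M.PosSemidef) :
    ∫ ω, (M * ((W ω - ∫ ω', W ω' ∂P) * (W ω - ∫ ω', W ω' ∂P))).trace.re ∂P ≤
      ∫ ω, (M * (W ω * W ω)).trace.re ∂P := by
  have hi : Integrable W P := integrable_of_norm_le hW hnorm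
  set E := ∫ ω, W ω ∂P with hE
  have hEh : E.IsHermitian := isHermitian_integral (.of_forall hherm) hi
  have hsq : Integrable (fun ω => W ω * W ω) P :=
    integrable_of_norm_le ((continuous_id.mul continuous_id).measurable.comp hW) (c := c * c)
      fun ω => (norm_mul_le _ _).trans
        (mul_le_mul (hnorm ω) (hnorm ω) (norm_nonneg _) ((norm_nonneg _).trans (hnorm ω)))
  have e : ∀ ω, (M * ((W ω - E) * (W ω - E))).trace.re = (M * (W ω * W ω)).trace.re -
      (((E * M + M * E) * W ω).trace.re - (M * (E * E)).trace.re) := fun ω => by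
    have h1 : (M * (W ω * E)).trace = (E * M * W ω).trace := by
      rw [← mul_assoc, Matrix.trace_mul_comm, mul_assoc]
    have h2 : M * ((W ω - E) * (W ω - E)) =
        M * (W ω * W ω) - M * (W ω * E) - M * E * W ω + M * (E * E) := by noncomm_ring
    rw [h2, Matrix.trace_add, Matrix.trace_sub, Matrix.trace_sub, h1, add_mul, Matrix.trace_add]
    simp only [Complex.add_re, Complex.sub_re]
    ring
  simp_rw [e]
  have i1 := integrable_traceMulRe_left hi (E * M + M * E)
  have i2 : Integrable (fun ω => ((E * M + M * E) * W ω).trace.re - (M * (E * E)).trace.re) P :=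
    i1.sub (integrable_const _)
  rw [integral_sub (integrable_traceMulRe_left hsq M) i2, integral_sub i1 (integrable_const _),
    integral_traceMulRe_left hi, ← hE]
  have h3 : ((E * M + M * E) * E).trace.re = 2 * (M * (E * E)).trace.re := by
    have : (E * M * E).trace = (M * (E * E)).trace := by
      rw [mul_assoc, Matrix.trace_mul_comm, mul_assoc]
    rw [add_mul, Matrix.trace_add, this, mul_assoc, Complex.add_re]; ring
  have h4 : 0 ≤ (M * (E * E)).trace.re := by
    refine re_trace_mul_nonneg hM ?_
    have := Matrix.posSemidef_conjTranspose_mul_self E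
    rwa [hEh.eq] at this
  rw [h3]
  simp
  linarith

variable {n : ℕ} {A : ℝ → Matrix (Fin m) (Fin m) ℂ} {a : ℝ} {τ : Fin n → Ω → ℝ}
  {X : Fin n → Ω → Matrix (Fin m) (Fin m) ℂ} {Y : Fin n → Ω → ℝ}

omit [IsProbabilityMeasure P] in
theorem IsSample.ae_mem_samplingSet (hS : IsSample P A a τ X Y) (j : Fin n) :
    ∀ᵐ ω ∂P, X j ω ∈ samplingSet m := by
  have h : ∀ᵐ x ∂(P.map (X j)), x ∈ samplingSet m := by
    rw [hS.law_design, uniformOn]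
    exact ae_cond_mem measurableSet_samplingSet
  exact ae_of_ae_map (hS.measurable_design j).aemeasurable h

omit [IsProbabilityMeasure P] in
theorem IsSample.truncatedTerm_ae_eq (hS : IsSample P A a τ X Y) (K : ℝ → ℝ) (h t : ℝ) (j : Fin n) :
    (fun ω => truncatedTerm K h a t (τ j ω, X j ω, Y j ω)) =ᵐ[P]
      fun ω => (K ((τ j ω - t) / h) * Y j ω) • X j ω := by
  filter_upwards [hS.ae_mem_samplingSet j, hS.bounded_response j] with ω h1 h2
  exact if_pos ⟨h1, h2⟩

omit [IsProbabilityMeasure P] in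
theorem IsSample.measurable_triple (hS : IsSample P A a τ X Y) (j : Fin n) :
    Measurable fun ω => (τ j ω, X j ω, Y j ω) :=
  (hS.measurable_time j).prodMk ((hS.measurable_design j).prodMk (hS.measurable_response j))

/-- The real linear map `B ↦ ⟨B, x⟩ x`. -/
noncomputable def designMap (x : Matrix (Fin m) (Fin m) ℂ) :
    Matrix (Fin m) (Fin m) ℂ →L[ℝ] Matrix (Fin m) (Fin m) ℂ :=
  ((traceMulRe (Fin m)).flip x).smulRight x

@[simp]
theorem designMap_apply (x B : Matrix (Fin m) (Fin m) ℂ) : designMap x B = hsInner B x • x := rfl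

theorem IsSample.integral_truncatedTerm [NeZero m] (hS : IsSample P A a τ X Y) {K : ℝ → ℝ}
    (hK : Continuous K) {M : ℝ} (hM : ∀ u, |K u| ≤ M) (ha : 0 ≤ a) (hAh : IsHermitianValued A)
    (hAc : ContinuousOn A (Icc 0 1)) (h t : ℝ) (j : Fin n) :
    ∫ ω, truncatedTerm K h a t (τ j ω, X j ω, Y j ω) ∂P =
      ((m : ℝ) ^ 2)⁻¹ • ∫ s in Icc (0 : ℝ) 1, K ((s - t) / h) • A s := by
  have hWi : Integrable (fun ω => truncatedTerm K h a t (τ j ω, X j ω, Y j ω)) P :=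
    integrable_of_norm_le ((measurable_truncatedTerm hK h a t).comp (hS.measurable_triple j))
      fun ω => norm_truncatedTerm_le hM ha h t _
  set g : Ω → Matrix (Fin m) (Fin m) ℂ := fun ω => K ((τ j ω - t) / h) • X j ω with hg
  have hpair : Measurable fun ω => (τ j ω, X j ω) :=
    (hS.measurable_time j).prodMk (hS.measurable_design j)
  have hWae : (fun ω => truncatedTerm K h a t (τ j ω, X j ω, Y j ω)) =ᵐ[P] Y j • g := by
    refine (hS.truncatedTerm_ae_eq K h t j).trans (.of_forall fun ω => ?_)
    simp only [hg, Pi.smul_apply', smul_smul, mul_comm]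
  have hYi : Integrable (Y j) P :=
    Integrable.of_bound (hS.measurable_response j).aestronglyMeasurable a
      (by simpa using hS.bounded_response j)
  have hgm : StronglyMeasurable[MeasurableSpace.comap (fun ω => (τ j ω, X j ω)) inferInstance] g := by
    have hG : Measurable fun q : ℝ × Matrix (Fin m) (Fin m) ℂ => K ((q.1 - t) / h) • q.2 := by
      have hKm := hK.measurable
      have h1 : Measurable fun q : ℝ × Matrix (Fin m) (Fin m) ℂ => K ((q.1 - t) / h) := by fun_prop
      exact h1.smul measurable_snd
    exact Measurable.stronglyMeasurable
      (hG.comp (comap_measurable fun ω => (τ j ω, X j ω)))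
  have hKt : Continuous fun s => K ((s - t) / h) := by fun_prop
  have hfint : IntegrableOn (fun s => K ((s - t) / h) • A s) (Icc 0 1) :=
    (hKt.continuousOn.smul hAc).integrableOn_Icc
  -- The expansion in `𝒳` used at the end holds for Hermitian matrices only.
  have hfherm : (∫ s in Icc (0 : ℝ) 1, K ((s - t) / h) • A s).IsHermitian := by
    refine isHermitian_integral ?_ hfint
    filter_upwards [ae_restrict_mem measurableSet_Icc] with s hs
    exact isHermitian_real_smul (hAh s hs) _
  calc ∫ ω, truncatedTerm K h a t (τ j ω, X j ω, Y j ω) ∂P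
      = ∫ ω, (Y j • g) ω ∂P := integral_congr_ae hWae
    _ = ∫ ω, (P[Y j • g | MeasurableSpace.comap (fun ω => (τ j ω, X j ω)) inferInstance]) ω ∂P :=
        (integral_condExp hpair.comap_le).symm
    _ = ∫ ω, designMap (X j ω) (K ((τ j ω - t) / h) • A (τ j ω)) ∂P := by
        refine integral_congr_ae ((condExp_smul_of_aestronglyMeasurable_right
          hYi (hWi.congr hWae) hgm.aestronglyMeasurable).trans ?_)
        filter_upwards [hS.regression j] with ω hω
        rw [Pi.smul_apply', hω, map_smul, designMap_apply, smul_comm]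
    -- Evaluation of a linear map at a vector is bilinear, so the independence of `X j` and `τ j`
    -- factors the expectation.
    _ = (∫ ω, designMap (X j ω) ∂P) (∫ ω, K ((τ j ω - t) / h) • A (τ j ω) ∂P) := by
        have hint2 : Integrable (fun s => K ((s - t) / h) • A s) (P.map (τ j)) := by
          rw [hS.law_time]; exact hfint
        have hint3 : Integrable (designMap (m := m)) (P.map (X j)) := by
          rw [hS.law_design]; exact integrable_uniformOn_samplingSet (designMap (m := m))
        exact (hS.indep_time_design j).integral_bilin_comp_comp
          (hS.measurable_time j).aemeasurable (hS.measurable_design j).aemeasurable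
          hint2 hint3 (ContinuousLinearMap.apply ℝ (Matrix (Fin m) (Fin m) ℂ))
    _ = (((m : ℝ) ^ 2)⁻¹ • ∑ p : Fin m × Fin m, designMap (basisMatrix m p.1 p.2))
          (∫ s in Icc (0 : ℝ) 1, K ((s - t) / h) • A s) := by
        have h1 : ∫ ω, designMap (X j ω) ∂P = ∫ x, designMap x ∂(P.map (X j)) := by
          refine (integral_map (hS.measurable_design j).aemeasurable ?_).symm
          rw [hS.law_design]; exact (integrable_uniformOn_samplingSet _).aestronglyMeasurable
        have h2 : ∫ ω, K ((τ j ω - t) / h) • A (τ j ω) ∂P =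
            ∫ s, K ((s - t) / h) • A s ∂(P.map (τ j)) := by
          refine (integral_map (f := fun s => K ((s - t) / h) • A s)
            (hS.measurable_time j).aemeasurable ?_).symm
          rw [hS.law_time]; exact hfint.aestronglyMeasurable
        rw [h1, h2, hS.law_design, hS.law_time, integral_uniformOn_samplingSet]
    _ = _ := by
        rw [smul_apply, sum_apply]
        simp only [designMap_apply]
        rw [sum_hsInner_smul_basisMatrix hfherm]

theorem setIntegral_kernel_sq_le {K : ℝ → ℝ} {ℓ : ℕ} (hK : IsAdmissibleKernel K ℓ) {M : ℝ}
    (hM : ∀ u, |K u| ≤ M) {h : ℝ} (hh : 0 < h) (t : ℝ) :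
    ∫ s in Icc (0 : ℝ) 1, K ((s - t) / h) ^ 2 ≤ 2 * h * M ^ 2 := by
  have hi : Integrable ((Icc (t - h) (t + h)).indicator fun _ => M ^ 2) :=
    (integrable_indicator_iff measurableSet_Icc).2 (by simp)
  have h1 : ∀ s, K ((s - t) / h) ^ 2 ≤ (Icc (t - h) (t + h)).indicator (fun _ => M ^ 2) s := by
    intro s
    by_cases hs : s ∈ Icc (t - h) (t + h)
    · rw [indicator_of_mem hs, ← sq_abs]
      exact pow_le_pow_left₀ (abs_nonneg _) (hM _) 2
    · rw [indicator_of_notMem hs, kernel_eq_zero hK, zero_pow two_ne_zero]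
      intro hu
      refine hs ⟨?_, ?_⟩
      · have := (le_div_iff₀ hh).1 hu.1; linarith
      · have := (div_le_iff₀ hh).1 hu.2; linarith
  calc ∫ s in Icc (0 : ℝ) 1, K ((s - t) / h) ^ 2
      ≤ ∫ s in Icc (0 : ℝ) 1, (Icc (t - h) (t + h)).indicator (fun _ => M ^ 2) s :=
        integral_mono_of_nonneg (.of_forall fun _ => sq_nonneg _) hi.integrableOn (.of_forall h1)
    _ ≤ ∫ s, (Icc (t - h) (t + h)).indicator (fun _ => M ^ 2) s :=
        setIntegral_le_integral hi
          (.of_forall fun s => indicator_nonneg (fun _ _ => sq_nonneg M) s)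
    _ = 2 * h * M ^ 2 := by
        rw [integral_indicator measurableSet_Icc, setIntegral_const, smul_eq_mul, Measure.real,
          Real.volume_Icc, ENNReal.toReal_ofReal (by linarith)]
        ring

/-- After bounding `Y²` by `a²`, the kernel and design factors are independent. Their means are at
most `2 h M²`, the kernel window having length `2 h`, and `tr N / m`. -/
theorem IsSample.integral_trace_mul_truncatedTerm_sq_le [NeZero m] (hS : IsSample P A a τ X Y)
    {K : ℝ → ℝ} {ℓ : ℕ} (hK : IsAdmissibleKernel K ℓ) (hKc : Continuous K) {M : ℝ}
    (hM : ∀ u, |K u| ≤ M) {h : ℝ} (hh : 0 < h) (t : ℝ) (j : Fin n)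
    {N : Matrix (Fin m) (Fin m) ℂ} (hN : N.PosSemidef) :
    ∫ ω, (N * (truncatedTerm K h a t (τ j ω, X j ω, Y j ω) *
      truncatedTerm K h a t (τ j ω, X j ω, Y j ω))).trace.re ∂P ≤
      2 * h * (M * a) ^ 2 / m * N.trace.re := by
  have hpsd : ∀ x ∈ samplingSet m, 0 ≤ (N * (x * x)).trace.re := fun x hx => by
    refine re_trace_mul_nonneg hN ?_
    have := Matrix.posSemidef_conjTranspose_mul_self x
    rwa [(isHermitian_of_mem_samplingSet hx).eq] at this
  have hNt : 0 ≤ N.trace.re := (Complex.nonneg_iff.1 hN.trace_nonneg).1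
  set φ : ℝ → ℝ := fun s => K ((s - t) / h) ^ 2 with hφ
  have hφc : Continuous φ := by fun_prop
  set ψ : Matrix (Fin m) (Fin m) ℂ → ℝ := fun x => (N * (x * x)).trace.re with hψ
  have hψc : Continuous ψ :=
    Complex.continuous_re.comp (continuous_const.mul (continuous_id.mul continuous_id)).matrix_trace
  have hφi : Integrable (fun ω => φ (τ j ω)) P := by
    refine Integrable.of_bound (hφc.measurable.comp (hS.measurable_time j)).aestronglyMeasurable
      (M ^ 2) (.of_forall fun ω => ?_)
    rw [Real.norm_eq_abs, abs_pow]
    exact pow_le_pow_left₀ (abs_nonneg _) (hM _) 2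
  have hψi : Integrable (fun ω => ψ (X j ω)) P := by
    have : Integrable ψ (P.map (X j)) := by
      rw [hS.law_design]; exact integrable_uniformOn_samplingSet _
    exact this.comp_measurable (hS.measurable_design j)
  have hI : IndepFun (fun ω => φ (τ j ω)) (fun ω => ψ (X j ω)) P :=
    (hS.indep_time_design j).comp hφc.measurable hψc.measurable
  have hprod : Integrable (fun ω => φ (τ j ω) * ψ (X j ω)) P := hI.integrable_mul hφi hψi
  have h1 : ∫ ω, (N * (truncatedTerm K h a t (τ j ω, X j ω, Y j ω) *
      truncatedTerm K h a t (τ j ω, X j ω, Y j ω))).trace.re ∂P ≤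
      ∫ ω, a ^ 2 * (φ (τ j ω) * ψ (X j ω)) ∂P := by
    refine integral_mono_of_nonneg (.of_forall fun ω => ?_) (hprod.const_mul _) ?_
    · refine re_trace_mul_nonneg hN ?_
      have := Matrix.posSemidef_conjTranspose_mul_self
        (truncatedTerm K h a t (τ j ω, X j ω, Y j ω))
      rwa [(isHermitian_truncatedTerm K h a t _).eq] at this
    · filter_upwards [hS.truncatedTerm_ae_eq K h t j, hS.ae_mem_samplingSet j,
        hS.bounded_response j] with ω e hx hy
      rw [e, smul_mul_smul_comm, mul_smul_comm, Matrix.trace_smul, Complex.smul_re, smul_eq_mul]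
      have h0 := hpsd _ hx
      have hy2 : Y j ω ^ 2 ≤ a ^ 2 := by
        rw [← sq_abs]; exact pow_le_pow_left₀ (abs_nonneg _) hy 2
      have : 0 ≤ φ (τ j ω) * ψ (X j ω) := mul_nonneg (sq_nonneg _) h0
      calc K ((τ j ω - t) / h) * Y j ω * (K ((τ j ω - t) / h) * Y j ω) * ψ (X j ω)
          = Y j ω ^ 2 * (φ (τ j ω) * ψ (X j ω)) := by rw [hφ]; ring
        _ ≤ _ := mul_le_mul_of_nonneg_right hy2 this
  refine h1.trans ?_
  have h2 : ∫ ω, φ (τ j ω) ∂P ≤ 2 * h * M ^ 2 := by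
    have := integral_map (μ := P) (f := φ) (hS.measurable_time j).aemeasurable
      hφc.measurable.aestronglyMeasurable
    rw [← this, hS.law_time]
    exact setIntegral_kernel_sq_le hK hM hh t
  have h3 : ∫ ω, ψ (X j ω) ∂P = N.trace.re / m := by
    have := integral_map (μ := P) (f := ψ) (hS.measurable_design j).aemeasurable
      hψc.measurable.aestronglyMeasurable
    rw [← this, hS.law_design, integral_uniformOn_samplingSet]
    have e : ∑ p : Fin m × Fin m, ψ (basisMatrix m p.1 p.2) = m * N.trace.re := by
      have := congrArg (fun Z => (N * Z).trace.re) (sum_basisMatrix_mul_self (m := m))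
      simp only [Finset.mul_sum, Matrix.trace_sum, Complex.re_sum, mul_smul_comm, mul_one,
        Matrix.trace_smul, smul_eq_mul] at this
      rw [hψ, this]
      simp
    rw [e, smul_eq_mul]
    have : (m : ℝ) ≠ 0 := NeZero.ne _
    field_simp
  rw [integral_const_mul, hI.integral_fun_mul_eq_mul_integral hφi.aestronglyMeasurable
    hψi.aestronglyMeasurable, h3]
  have h4 : 0 ≤ N.trace.re / m := by positivity
  calc a ^ 2 * ((∫ ω, φ (τ j ω) ∂P) * (N.trace.re / m))
      ≤ a ^ 2 * (2 * h * M ^ 2 * (N.trace.re / m)) := by gcongr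
    _ = _ := by ring

end Summand

end MatrixFunctionEstimation

namespace MatrixFunctionEstimation

open scoped Matrix Matrix.Norms.L2Operator ComplexOrder

/-! ### Uniform deviation and the bias–deviation decomposition -/

section Deviation

variable {m : ℕ}

theorem norm_le_card_mul_of_norm_apply_le {N : Matrix (Fin m) (Fin m) ℂ} {c : ℝ} (hc : 0 ≤ c)
    (hN : ∀ a b, ‖N a b‖ ≤ c) : ‖N‖ ≤ m * c := by
  rw [Matrix.cstar_norm_def]
  refine ContinuousLinearMap.opNorm_le_bound _ (by positivity) fun x => ?_
  refine abs_le_of_sq_le_sq' ?_ (by positivity) |>.2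
  have hrow : ∀ a, ‖(Matrix.toEuclideanCLM (n := Fin m) (𝕜 := ℂ) N x) a‖ ^ 2 ≤
      c ^ 2 * (m * ∑ b, ‖x b‖ ^ 2) := fun a => by
    have h1 : ‖(Matrix.toEuclideanCLM (n := Fin m) (𝕜 := ℂ) N x) a‖ ≤ c * ∑ b, ‖x b‖ := by
      rw [Matrix.ofLp_toEuclideanCLM, Matrix.mulVec, dotProduct, Finset.mul_sum]
      refine (norm_sum_le _ _).trans (Finset.sum_le_sum fun b _ => ?_)
      rw [norm_mul]
      exact mul_le_mul_of_nonneg_right (hN a b) (norm_nonneg _)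
    refine (pow_le_pow_left₀ (norm_nonneg _) h1 2).trans ?_
    rw [mul_pow]
    refine mul_le_mul_of_nonneg_left ?_ (sq_nonneg c)
    simpa using sq_sum_le_card_mul_sum_sq (s := Finset.univ) (f := fun b => ‖x b‖)
  rw [EuclideanSpace.norm_sq_eq, mul_pow, EuclideanSpace.norm_sq_eq]
  refine (Finset.sum_le_sum fun a _ => hrow a).trans (le_of_eq ?_)
  simp
  ring

/-- Real and imaginary parts contribute a constant `2` each, hence `4`; the factor `m` is the price
of passing from entries to the operator norm. -/
theorem norm_smoothing_sub_le {K : ℝ → ℝ} {ℓ : ℕ} (hK : IsAdmissibleKernel K ℓ) {M : ℝ}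
    (hM : ∀ u, |K u| ≤ M) {β L : ℝ} {A : ℝ → Matrix (Fin m) (Fin m) ℂ} (hβ : 0 < β)
    (hℓ : ⌊β⌋₊ = ℓ) (hL : 0 ≤ L) (hA : HasHolderEntries β L A) {h t : ℝ} (hh : 0 < h)
    (ht : t ∈ Icc h (1 - h)) :
    ‖(∫ s in Icc (0 : ℝ) 1, K ((s - t) / h) • A s) - h • A t‖ ≤ m * (h * (4 * M * L * h ^ β)) := by
  obtain ⟨LK, -, hLK⟩ := hK.lipschitz
  have hKc := hLK.continuous
  have hM0 : 0 ≤ M := (abs_nonneg _).trans (hM 0)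
  have hKt : Continuous fun s => K ((s - t) / h) := by fun_prop
  have hi : IntegrableOn (fun s => K ((s - t) / h) • A s) (Icc 0 1) :=
    (hKt.continuousOn.smul (hA.continuousOn hβ)).integrableOn_Icc
  refine norm_le_card_mul_of_norm_apply_le (by positivity) fun a b => ?_
  have hre := (LinearMap.toContinuousLinearMap
    (Complex.reLm ∘ₗ Matrix.entryLinearMap ℝ ℂ a b)).integral_comp_comm hi
  have him := (LinearMap.toContinuousLinearMap
    (Complex.imLm ∘ₗ Matrix.entryLinearMap ℝ ℂ a b)).integral_comp_comm hi
  simp only [LinearMap.coe_toContinuousLinearMap', LinearMap.comp_apply,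
    Matrix.entryLinearMap_apply, Matrix.smul_apply, Complex.reLm_coe, Complex.imLm_coe,
    Complex.smul_re, Complex.smul_im, smul_eq_mul] at hre him
  have h1 := abs_kernel_smoothing_sub_le hK hM hβ hℓ hL (hA a b).1 hh ht
  have h2 := abs_kernel_smoothing_sub_le hK hM hβ hℓ hL (hA a b).2 hh ht
  rw [hre] at h1
  rw [him] at h2
  refine (Complex.norm_le_abs_re_add_abs_im _).trans ?_
  simp only [Matrix.sub_apply, Matrix.smul_apply, Complex.sub_re, Complex.sub_im, Complex.smul_re,
    Complex.smul_im, smul_eq_mul]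
  linarith

variable {Ω : Type*} [MeasurableSpace Ω] {P : Measure Ω} [IsProbabilityMeasure P]
  {n : ℕ} {A : ℝ → Matrix (Fin m) (Fin m) ℂ} {a : ℝ} {τ : Fin n → Ω → ℝ}
  {X : Fin n → Ω → Matrix (Fin m) (Fin m) ℂ} {Y : Fin n → Ω → ℝ}

/-- The centred truncated summand of the kernel estimator. -/
noncomputable def centeredTerm (P : Measure Ω) (K : ℝ → ℝ) (h a : ℝ) (τ : Fin n → Ω → ℝ)
    (X : Fin n → Ω → Matrix (Fin m) (Fin m) ℂ) (Y : Fin n → Ω → ℝ) (t : ℝ) (j : Fin n) (ω : Ω) :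
    Matrix (Fin m) (Fin m) ℂ :=
  truncatedTerm K h a t (τ j ω, X j ω, Y j ω) -
    ∫ ω', truncatedTerm K h a t (τ j ω', X j ω', Y j ω') ∂P

/-- The deviation level of the sum of the centred summands at a single point. -/
noncomputable def deviationLevel (M h a r : ℝ) (m n : ℕ) : ℝ :=
  2 * r * (2 * (M * a)) + 2 * √(n * (2 * h * (M * a) ^ 2 / m) * r)

theorem IsSample.measureReal_deviation_le [NeZero m] (hS : IsSample P A a τ X Y) {K : ℝ → ℝ} {ℓ : ℕ}
    (hK : IsAdmissibleKernel K ℓ) {M : ℝ} (hM0 : 0 < M) (hM : ∀ u, |K u| ≤ M) (ha : 0 < a) {h : ℝ}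
    (hh : 0 < h) {r : ℝ} (hr : 0 < r) (t : ℝ) :
    P.real {ω | deviationLevel M h a r m n ≤ ‖∑ j, centeredTerm P K h a τ X Y t j ω‖} ≤
      2 * m * Real.exp (-r) := by
  obtain ⟨LK, -, hLK⟩ := hK.lipschitz
  have hKc := hLK.continuous
  have hWm : ∀ j, Measurable fun ω => truncatedTerm K h a t (τ j ω, X j ω, Y j ω) := fun j =>
    (measurable_truncatedTerm hKc h a t).comp (hS.measurable_triple j)
  have hWn : ∀ j ω, ‖truncatedTerm K h a t (τ j ω, X j ω, Y j ω)‖ ≤ M * a := fun j ω =>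
    norm_truncatedTerm_le hM ha.le h t _
  have hWh : ∀ j ω, (truncatedTerm K h a t (τ j ω, X j ω, Y j ω)).IsHermitian := fun j ω =>
    isHermitian_truncatedTerm K h a t _
  have hWi : ∀ j, Integrable (fun ω => truncatedTerm K h a t (τ j ω, X j ω, Y j ω)) P := fun j =>
    integrable_of_norm_le (hWm j) (hWn j)
  have key := measureReal_bernstein_le (P := P) (Z := centeredTerm P K h a τ X Y t)
    (U := 2 * (M * a)) (v := 2 * h * (M * a) ^ 2 / m) (r := r)
    (fun j => (hWm j).sub_const _)
    (hS.indep.comp (fun j p => truncatedTerm K h a t p -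
      ∫ ω', truncatedTerm K h a t (τ j ω', X j ω', Y j ω') ∂P)
      fun j => (measurable_truncatedTerm hKc h a t).sub_const _)
    (fun j ω => (hWh j ω).sub (isHermitian_integral (.of_forall (hWh j)) (hWi j)))
    (fun j ω => by
      have h2 := norm_integral_le_of_norm_le_const (μ := P) (.of_forall (hWn j))
      rw [probReal_univ, mul_one] at h2
      refine (norm_sub_le _ _).trans ?_
      linarith [hWn j ω])
    (fun j => by
      unfold centeredTerm
      rw [integral_sub (hWi j) (integrable_const _)]
      simp)
    (fun j N hN => (integral_trace_mul_centered_sq_le (hWm j) (hWh j) (hWn j) hN).trans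
      (hS.integral_trace_mul_truncatedTerm_sq_le hK hKc hM hh t j hN))
    (by positivity) (by positivity) hr
  rw [Fintype.card_fin] at key
  exact key

theorem IsSample.norm_centeredTerm_sub_le (hS : IsSample P A a τ X Y) {K : ℝ → ℝ} {M : ℝ}
    (hM : ∀ u, |K u| ≤ M) {LK : NNReal} (hLK : LipschitzWith LK K) (ha : 0 ≤ a) {h : ℝ}
    (hh : 0 < h) (t t' : ℝ) (j : Fin n) (ω : Ω) :
    ‖centeredTerm P K h a τ X Y t j ω - centeredTerm P K h a τ X Y t' j ω‖ ≤
      2 * (LK * (|t - t'| / h) * a) := by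
  have hWi : ∀ t, Integrable (fun ω => truncatedTerm K h a t (τ j ω, X j ω, Y j ω)) P := fun t =>
    integrable_of_norm_le
      ((measurable_truncatedTerm hLK.continuous h a t).comp (hS.measurable_triple j))
      fun ω => norm_truncatedTerm_le hM ha h t _
  unfold centeredTerm
  rw [sub_sub_sub_comm, ← integral_sub (hWi t) (hWi t')]
  have h1 : ∀ ω, ‖truncatedTerm K h a t (τ j ω, X j ω, Y j ω) -
      truncatedTerm K h a t' (τ j ω, X j ω, Y j ω)‖ ≤ LK * (|t - t'| / h) * a := fun ω =>
    norm_truncatedTerm_sub_le hLK hh ha t t' _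
  have h2 := norm_integral_le_of_norm_le_const (μ := P) (.of_forall h1)
  rw [probReal_univ, mul_one] at h2
  refine (norm_sub_le _ _).trans ?_
  linarith [h1 ω]

/-- Uniform deviation bound over `[0, 1]`, from a union bound over a grid of mesh `h / n`. -/
theorem IsSample.le_measureReal_uniform_deviation [NeZero m] [NeZero n] (hS : IsSample P A a τ X Y)
    {K : ℝ → ℝ} {ℓ : ℕ} (hK : IsAdmissibleKernel K ℓ) {LK : NNReal} (hLK : LipschitzWith LK K)
    {M : ℝ} (hM0 : 0 < M) (hM : ∀ u, |K u| ≤ M) (ha : 0 < a) {h : ℝ} (hh : 0 < h) {r : ℝ}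
    (hr : 0 < r) :
    1 - (n / h + 1) * (2 * m * Real.exp (-r)) ≤
      P.real {ω | ∀ t ∈ Icc (0 : ℝ) 1, ‖∑ j, centeredTerm P K h a τ X Y t j ω‖ ≤
        deviationLevel M h a r m n + 2 * LK * a} := by
  have hn : (0 : ℝ) < n := Nat.cast_pos.2 (NeZero.pos n)
  set δ : ℝ := h / n with hδ
  have hδ0 : 0 < δ := by positivity
  set bad : Set Ω := ⋃ i ∈ Finset.range (⌊n / h⌋₊ + 1), {ω | deviationLevel M h a r m n ≤
    ‖∑ j, centeredTerm P K h a τ X Y (i * δ) j ω‖} with hbad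
  have hbadP : P.real bad ≤ (n / h + 1) * (2 * m * Real.exp (-r)) := by
    refine (measureReal_biUnion_finset_le _ _).trans ?_
    refine (Finset.sum_le_sum fun i _ => hS.measureReal_deviation_le hK hM0 hM ha hh hr _).trans ?_
    rw [Finset.sum_const, Finset.card_range, nsmul_eq_mul]
    refine mul_le_mul_of_nonneg_right ?_ (by positivity)
    push_cast
    have := Nat.floor_le (show 0 ≤ n / h by positivity)
    linarith
  set good : Set Ω := {ω | ∀ t ∈ Icc (0 : ℝ) 1, ‖∑ j, centeredTerm P K h a τ X Y t j ω‖ ≤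
        deviationLevel M h a r m n + 2 * LK * a} with hgood
  -- Covering the space and using subadditivity avoids proving that `good`, an intersection over
  -- uncountably many `t`, is measurable.
  have hcover : (univ : Set Ω) ⊆ good ∪ bad := by
    intro ω _
    by_cases hω : ω ∈ bad
    · exact .inr hω
    refine .inl fun t ht => ?_
    have hfl := Nat.floor_le (show 0 ≤ t / δ from div_nonneg ht.1 hδ0.le)
    have hfl2 := Nat.lt_floor_add_one (t / δ)
    set i := ⌊t / δ⌋₊ with hi
    have hile : i < ⌊n / h⌋₊ + 1 := by
      refine Nat.lt_succ_of_le (Nat.floor_le_floor ?_)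
      rw [hδ, div_div_eq_mul_div]
      gcongr
      nlinarith [ht.2]
    have hdist : |t - i * δ| ≤ δ := by
      rw [le_div_iff₀ hδ0] at hfl
      rw [div_lt_iff₀ hδ0] at hfl2
      rw [abs_le]; constructor <;> nlinarith
    have hi_good : ‖∑ j, centeredTerm P K h a τ X Y (i * δ) j ω‖ < deviationLevel M h a r m n := by
      by_contra hcon
      refine hω (mem_biUnion (Finset.mem_coe.2 (Finset.mem_range.2 hile)) ?_)
      exact not_lt.1 hcon
    -- Within one mesh `h / n` each summand moves by at most `2 LK a / n`, so the whole sum moves by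
    -- a bounded amount.
    have hdiff : ‖∑ j, centeredTerm P K h a τ X Y t j ω -
        ∑ j, centeredTerm P K h a τ X Y (i * δ) j ω‖ ≤ 2 * LK * a := by
      rw [← Finset.sum_sub_distrib]
      refine (norm_sum_le _ _).trans ?_
      refine (Finset.sum_le_sum fun j _ =>
        hS.norm_centeredTerm_sub_le hM hLK ha.le hh t (i * δ) j ω).trans ?_
      rw [Finset.sum_const, Finset.card_univ, Fintype.card_fin, nsmul_eq_mul]
      have h1 : |t - i * δ| / h ≤ 1 / n := by
        rw [div_le_div_iff₀ hh hn, one_mul]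
        rwa [hδ, le_div_iff₀ hn] at hdist
      calc (n : ℝ) * (2 * (LK * (|t - i * δ| / h) * a))
          ≤ n * (2 * (LK * (1 / n) * a)) := by gcongr
        _ = 2 * LK * a := by field_simp
    have := norm_add_le (∑ j, centeredTerm P K h a τ X Y t j ω -
        ∑ j, centeredTerm P K h a τ X Y (i * δ) j ω) (∑ j, centeredTerm P K h a τ X Y (i * δ) j ω)
    rw [sub_add_cancel] at this
    linarith
  have h1 : (1 : ℝ) ≤ P.real good + P.real bad := by
    rw [← probReal_univ (μ := P)]
    exact (measureReal_mono hcover).trans (measureReal_union_le _ _)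
  linarith

/-- Uniform deviation bound for the kernel estimator. -/
theorem IsSample.le_measureReal_kernelEstimator [NeZero m] [NeZero n] (hS : IsSample P A a τ X Y)
    {K : ℝ → ℝ} {ℓ : ℕ} (hK : IsAdmissibleKernel K ℓ) {LK : NNReal} (hLK : LipschitzWith LK K)
    {M : ℝ} (hM0 : 0 < M) (hM : ∀ u, |K u| ≤ M) (ha : 0 < a) {β L : ℝ} (hβ : 0 < β)
    (hℓ : ⌊β⌋₊ = ℓ) (hL : 0 ≤ L) (hAh : IsHermitianValued A) (hA : HasHolderEntries β L A)
    {h : ℝ} (hh : 0 < h) {r : ℝ} (hr : 0 < r) :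
    1 - (n / h + 1) * (2 * m * Real.exp (-r)) ≤
      P.real {ω | ∀ t ∈ Icc h (1 - h),
        1 / (m : ℝ) ^ 2 * opNorm (kernelEstimator K h
          (fun j => τ j ω) (fun j => X j ω) (fun j => Y j ω) t - A t) ^ 2 ≤
        (m / (n * h) * (deviationLevel M h a r m n + 2 * LK * a) + 4 * M * L * h ^ β) ^ 2} := by
  have hn : (0 : ℝ) < n := Nat.cast_pos.2 (NeZero.pos n)
  have hm : (0 : ℝ) < m := Nat.cast_pos.2 (NeZero.pos m)
  refine (hS.le_measureReal_uniform_deviation hK hLK hM0 hM ha hh hr).trans ?_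
  -- The inclusion of events holds only almost surely, because truncated and original summands agree
  -- off a null set.
  refine ENNReal.toReal_mono (measure_ne_top _ _) (measure_mono_ae ?_)
  have hae : ∀ᵐ ω ∂P, ∀ j, X j ω ∈ samplingSet m ∧ |Y j ω| ≤ a :=
    ae_all_iff.2 fun j => (hS.ae_mem_samplingSet j).and (hS.bounded_response j)
  filter_upwards [hae] with ω hω hdev t ht
  have hdev : ∀ t ∈ Icc (0 : ℝ) 1, ‖∑ j, centeredTerm P K h a τ X Y t j ω‖ ≤
        deviationLevel M h a r m n + 2 * LK * a := hdev
  have hD := hdev t ⟨by linarith [ht.1], by linarith [ht.2]⟩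
  have hB := norm_smoothing_sub_le hK hM hβ hℓ hL hA hh ht
  set D := ∑ j, centeredTerm P K h a τ X Y t j ω with hDdef
  set S := ∫ s in Icc (0 : ℝ) 1, K ((s - t) / h) • A s with hSdef
  have hDe : D = ∑ j, (K ((τ j ω - t) / h) * Y j ω) • X j ω - (n : ℝ) • ((m : ℝ) ^ 2)⁻¹ • S := by
    rw [hDdef]
    unfold centeredTerm
    rw [Finset.sum_sub_distrib]
    congr 1
    · exact Finset.sum_congr rfl fun j _ => if_pos (hω j)
    · rw [Finset.sum_congr rfl fun j _ => hS.integral_truncatedTerm hLK.continuous hM ha.le hAh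
        (hA.continuousOn hβ) h t j, Finset.sum_const, Finset.card_univ, Fintype.card_fin,
        ← Nat.cast_smul_eq_nsmul ℝ]
  have hdecomp : kernelEstimator K h (fun j => τ j ω) (fun j => X j ω) (fun j => Y j ω) t - A t =
      ((m : ℝ) ^ 2 / (n * h)) • D + h⁻¹ • (S - h • A t) := by
    have e1 : (m : ℝ) ^ 2 / (n * h) * n * ((m : ℝ) ^ 2)⁻¹ = h⁻¹ := by field_simp
    rw [hDe, kernelEstimator, smul_sub, smul_sub, smul_smul, smul_smul, smul_smul,
      inv_mul_cancel₀ hh.ne', one_smul, e1]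
    abel
  have hnorm : opNorm (kernelEstimator K h
      (fun j => τ j ω) (fun j => X j ω) (fun j => Y j ω) t - A t) ≤
      m * (m / (n * h) * (deviationLevel M h a r m n + 2 * LK * a) + 4 * M * L * h ^ β) := by
    have e : opNorm (kernelEstimator K h
      (fun j => τ j ω) (fun j => X j ω) (fun j => Y j ω) t - A t) = ‖kernelEstimator K h
      (fun j => τ j ω) (fun j => X j ω) (fun j => Y j ω) t - A t‖ := rfl
    rw [e, hdecomp]
    refine (norm_add_le _ _).trans ?_
    rw [norm_smul, norm_smul, Real.norm_of_nonneg (by positivity), Real.norm_of_nonneg (by positivity)]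
    calc (m : ℝ) ^ 2 / (n * h) * ‖D‖ + h⁻¹ * ‖S - h • A t‖
        ≤ (m : ℝ) ^ 2 / (n * h) * (deviationLevel M h a r m n + 2 * LK * a) +
          h⁻¹ * (m * (h * (4 * M * L * h ^ β))) := by gcongr
      _ = _ := by field_simp
  have h0 : 0 ≤ opNorm (kernelEstimator K h
      (fun j => τ j ω) (fun j => X j ω) (fun j => Y j ω) t - A t) := norm_nonneg _
  have h3 := pow_le_pow_left₀ h0 hnorm 2
  rw [mul_pow] at h3
  rw [one_div, inv_mul_le_iff₀ (by positivity)]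
  exact h3

end Deviation

end MatrixFunctionEstimation

namespace MatrixFunctionEstimation

/-! ### Calibration of the bandwidth and of the deviation level -/

section Rate

theorem rateBase_pos {β L a : ℝ} (hβ : 0 < β) (hL : 0 < L) (ha : 0 < a) {m n : ℕ} (hm : 1 ≤ m)
    (hn : 2 ≤ n) : 0 < rateBase β L a m n := by
  have hm' : (0 : ℝ) < m := Nat.cast_pos.2 hm
  have hn' : (0 : ℝ) < n := Nat.cast_pos.2 (by omega)
  have hlog : 0 < Real.log n := Real.log_pos (by exact_mod_cast hn)
  have hf : (0 : ℝ) < Nat.factorial ⌊β⌋₊ := Nat.cast_pos.2 (Nat.factorial_pos _)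
  unfold rateBase
  positivity

/-- With `x` the bandwidth divided by `c`, the rate base is `x ^ (2 β) * x`, and division by `c x`
leaves the squared bias order. Using `⌊β⌋! ≥ 1` and `β ≤ ℓ + 1` keeps the constant free of `β`. -/
theorem sq_mul_variance_ratio_le {c β L a : ℝ} {ℓ : ℕ} (hc : 0 < c) (hβ : 0 < β) (hℓ : ⌊β⌋₊ = ℓ)
    (hL : 0 < L) (ha : 0 < a) {m n : ℕ} (hm : 1 ≤ m) (hn : 2 ≤ n) {x : ℝ} (hx : 0 < x)
    (hρ : rateBase β L a m n = x ^ (2 * β) * x) :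
    a ^ 2 * (m * Real.log n / (n * (c * x))) ≤ 2 * (ℓ + 1) / c * (L ^ 2 * x ^ (2 * β)) := by
  have hn' : (0 : ℝ) < n := Nat.cast_pos.2 (by omega)
  have hf : (1 : ℝ) ≤ Nat.factorial ⌊β⌋₊ := by exact_mod_cast Nat.factorial_pos _
  have hf2 : (1 : ℝ) ≤ (Nat.factorial ⌊β⌋₊ : ℝ) ^ 2 := one_le_pow₀ hf
  have hβℓ : β ≤ ℓ + 1 := by rw [← hℓ]; exact (Nat.lt_floor_add_one β).le
  have hlog : 0 ≤ Real.log n := Real.log_natCast_nonneg n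
  have hxp : 0 < x ^ (2 * β) := Real.rpow_pos_of_pos hx _
  have h1 : a ^ 2 * (m * Real.log n / n) ≤ 2 * β * L ^ 2 * (x ^ (2 * β) * x) := by
    rw [← hρ, rateBase]
    have e : 2 * β * L ^ 2 * (a ^ 2 * (Nat.factorial ⌊β⌋₊ : ℝ) ^ 2 * m * Real.log n /
        (2 * β * L ^ 2 * n)) = (Nat.factorial ⌊β⌋₊ : ℝ) ^ 2 * (a ^ 2 * (m * Real.log n / n)) := by
      field_simp
    rw [e]
    exact le_mul_of_one_le_left (by positivity) hf2
  calc a ^ 2 * (m * Real.log n / (n * (c * x)))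
      = (a ^ 2 * (m * Real.log n / n)) / (c * x) := by field_simp
    _ ≤ (2 * β * L ^ 2 * (x ^ (2 * β) * x)) / (c * x) := by gcongr
    _ = 2 * β / c * (L ^ 2 * x ^ (2 * β)) := by field_simp
    _ ≤ _ := by gcongr

theorem rpow_two_mul_le_pow {x G β : ℝ} {ℓ : ℕ} (hx : 0 ≤ x) (hxG : x ≤ G) (hG : 1 ≤ G)
    (hβ : 0 ≤ β) (hβℓ : β ≤ ℓ + 1) : x ^ (2 * β) ≤ G ^ (2 * (ℓ + 1)) := by
  calc x ^ (2 * β) ≤ G ^ (2 * β) := Real.rpow_le_rpow hx hxG (by positivity)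
    _ ≤ G ^ ((2 * (ℓ + 1) : ℕ) : ℝ) :=
        Real.rpow_le_rpow_of_exponent_le hG (by push_cast; linarith)
    _ = _ := Real.rpow_natCast _ _

/-- Since `log n ≥ log 2`, the constant `log (6 Q)` can be written as a multiple of `log n`. -/
theorem exp_neg_mul_log_le {Q : ℝ} (hQ : 1 ≤ Q) {n : ℕ} (hn : 2 ≤ n) :
    Real.exp (-((4 + Real.log (6 * Q) / Real.log 2) * Real.log n)) ≤ ((n : ℝ) ^ 4 * (6 * Q))⁻¹ := by
  have hn' : (0 : ℝ) < n := Nat.cast_pos.2 (by omega)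
  have hl2 : 0 < Real.log 2 := Real.log_pos one_lt_two
  have hlog : Real.log 2 ≤ Real.log n := Real.log_le_log two_pos (by exact_mod_cast hn)
  have hlQ : 0 ≤ Real.log (6 * Q) := Real.log_nonneg (by linarith)
  rw [Real.exp_neg]
  refine inv_anti₀ (by positivity) ?_
  have e1 : (n : ℝ) ^ 4 * (6 * Q) = Real.exp (4 * Real.log n + Real.log (6 * Q)) := by
    rw [Real.exp_add, Real.exp_log (by positivity)]
    congr 1
    rw [show (4 : ℝ) = ((4 : ℕ) : ℝ) by norm_num, Real.exp_nat_mul, Real.exp_log hn']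
  rw [e1]
  refine Real.exp_le_exp.2 ?_
  have : Real.log (6 * Q) ≤ Real.log (6 * Q) / Real.log 2 * Real.log n := by
    rw [div_mul_eq_mul_div, le_div_iff₀ hl2]
    exact mul_le_mul_of_nonneg_left hlog hlQ
  nlinarith

/-- Grid size times dimension is of order `n² · m / (n h)`, and `m / (n h) ≤ Q / 0.69` since `log n
≥ log 2`. The factor `n⁻⁴ / (6 Q)` then leaves `n⁻²`, as `4 < 6 · 0.69`. -/
theorem union_bound_le {Q h : ℝ} {m n : ℕ} (hQ : 1 ≤ Q) (hn : 2 ≤ n) (hh : 0 < h) (hh1 : h ≤ 1)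
    (hq : m * Real.log n / (n * h) ≤ Q) :
    (n / h + 1) * (2 * m * Real.exp (-((4 + Real.log (6 * Q) / Real.log 2) * Real.log n))) ≤
      1 / (n : ℝ) ^ 2 := by
  have hn' : (2 : ℝ) ≤ n := by exact_mod_cast hn
  have hl2 : 0.6931471803 < Real.log 2 := Real.log_two_gt_d9
  have hlog : Real.log 2 ≤ Real.log n := Real.log_le_log two_pos hn'
  have h1 : (1 : ℝ) ≤ n / h := by rw [le_div_iff₀ hh]; linarith
  have h2 : (m : ℝ) / (n * h) * 0.69 ≤ Q := by
    refine le_trans ?_ hq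
    rw [mul_div_right_comm]
    gcongr
    linarith
  have hE := exp_neg_mul_log_le hQ hn
  calc (n / h + 1) * (2 * m * Real.exp (-((4 + Real.log (6 * Q) / Real.log 2) * Real.log n)))
      ≤ (n / h + n / h) * (2 * m * ((n : ℝ) ^ 4 * (6 * Q))⁻¹) := by gcongr
    _ = 4 * (m / (n * h)) / (6 * Q) * (1 / (n : ℝ) ^ 2) := by field_simp; ring
    _ ≤ 1 * (1 / (n : ℝ) ^ 2) := by
        gcongr
        rw [div_le_one (by positivity)]
        linarith
    _ = _ := one_mul _

/-- Put `q = m log n / (n h)`. The square root term is of order `a √q`; the linear term is of order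
`a q`, and `q ≤ √Q √q` reduces it to the same order. The discretisation error is absorbed in the
linear term, turning `4 r` into `5 r`. -/
theorem deviationLevel_le {M h a r κ Q LK : ℝ} {m n : ℕ} (hM : 0 < M) (hh : 0 < h) (ha : 0 < a)
    (hκ : 0 ≤ κ) (hm : 1 ≤ m) (hn : 1 ≤ n) (hr : r = κ * Real.log n) (hr1 : 1 ≤ r)
    (hLK : 2 * LK ≤ M) (hq : m * Real.log n / (n * h) ≤ Q) :
    m / (n * h) * (deviationLevel M h a r m n + 2 * LK * a) ≤
      M * (5 * κ * √Q + 2 * √(2 * κ)) * (a * √(m * Real.log n / (n * h))) := by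
  have hm' : (0 : ℝ) < m := Nat.cast_pos.2 hm
  have hn' : (0 : ℝ) < n := Nat.cast_pos.2 hn
  have hlog : 0 ≤ Real.log n := Real.log_natCast_nonneg n
  set q := m * Real.log n / (n * h) with hqdef
  have hq0 : 0 ≤ q := by positivity
  have hw : √q * √q = q := Real.mul_self_sqrt hq0
  have hwQ : √q ≤ √Q := Real.sqrt_le_sqrt hq
  have hs : √(n * (2 * h * (M * a) ^ 2 / m) * r) ≤ √(2 * κ) * (M * a) * (n * h / m) * √q := by
    refine Real.sqrt_le_iff.2 ⟨by positivity, le_of_eq ?_⟩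
    have e : (√(2 * κ) * (M * a) * (n * h / m) * √q) ^ 2 =
        √(2 * κ) ^ 2 * (M * a) ^ 2 * (n * h / m) ^ 2 * √q ^ 2 := by ring
    rw [e, Real.sq_sqrt (by positivity), Real.sq_sqrt hq0, hqdef, hr]
    field_simp
  have h1 : deviationLevel M h a r m n + 2 * LK * a ≤
      5 * r * (M * a) + 2 * (√(2 * κ) * (M * a) * (n * h / m) * √q) := by
    unfold deviationLevel
    have h2 : 2 * LK * a ≤ M * a := by gcongr
    have h3 : M * a ≤ r * (M * a) := le_mul_of_one_le_left (by positivity) hr1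
    linarith
  have e : (m : ℝ) / (n * h) * r = κ * (√q * √q) := by rw [hw, hqdef, hr]; ring
  calc m / (n * h) * (deviationLevel M h a r m n + 2 * LK * a)
      ≤ m / (n * h) * (5 * r * (M * a) + 2 * (√(2 * κ) * (M * a) * (n * h / m) * √q)) := by gcongr
    _ = 5 * (m / (n * h) * r) * (M * a) + 2 * √(2 * κ) * (M * a) * √q := by field_simp
    _ = 5 * κ * √q * √q * (M * a) + 2 * √(2 * κ) * (M * a) * √q := by rw [e]; ring
    _ ≤ 5 * κ * √Q * √q * (M * a) + 2 * √(2 * κ) * (M * a) * √q := by gcongr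
    _ = _ := by ring

end Rate

end MatrixFunctionEstimation

/-! ### The main theorem -/

open MatrixFunctionEstimation in
theorem mainTheorem3 (ℓ : ℕ) (K : ℝ → ℝ) (hK : IsAdmissibleKernel K ℓ)
    (c : ℝ) (hc : 0 < c) (B : ℝ) :
    ∃ C : ℝ, 0 < C ∧
      ∀ (β L a a₁ : ℝ), 0 < β → ⌊β⌋₊ = ℓ → 0 < L → 0 < a → L ≤ B * a →
      ∀ (m n : ℕ), 1 ≤ m → 1 ≤ n →
      ∀ (A : ℝ → Matrix (Fin m) (Fin m) ℂ), IsHermitianValued A →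
        IsBoundedOnSampling a₁ A → HasHolderEntries β L A →
      ∀ (Ω : Type*) [MeasurableSpace Ω] (P : Measure Ω) [IsProbabilityMeasure P]
        (τ : Fin n → Ω → ℝ) (X : Fin n → Ω → Matrix (Fin m) (Fin m) ℂ) (Y : Fin n → Ω → ℝ),
        IsSample P A a τ X Y →
        1 - 1 / (n : ℝ) ^ 2 ≤
          P.real {ω | ∀ t ∈ Icc (bandwidth c β L a m n) (1 - bandwidth c β L a m n),
            1 / (m : ℝ) ^ 2 *
              opNorm (kernelEstimator K (bandwidth c β L a m n)
                (fun j => τ j ω) (fun j => X j ω) (fun j => Y j ω) t - A t) ^ 2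
              ≤ C * L ^ 2 * rateBase β L a m n ^ (2 * β / (2 * β + 1))} := by
  obtain ⟨LK, hLK0, hLK⟩ := hK.lipschitz
  have hLK0' : (0 : ℝ) < LK := hLK0
  set M : ℝ := 3 * LK with hMdef
  have hM0 : 0 < M := by positivity
  have hM : ∀ u, |K u| ≤ M := abs_kernel_le hK hLK
  set c₂ : ℝ := 2 * (ℓ + 1) / c with hc₂
  have hc₂0 : 0 < c₂ := by positivity
  -- `G` bounds `x = h / c` when `h ≤ 1/2`. `Q` bounds `m log n / (n h)`: the bandwidth gives `a² q
  -- ≤ c₂ L² x ^ (2 β)`, and `L ≤ B a` allows cancelling `a²`.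
  set G : ℝ := max 1 (1 / (2 * c)) with hG
  set Q : ℝ := max 1 (c₂ * (B ^ 2 * G ^ (2 * (ℓ + 1)))) with hQ
  have hQ1 : 1 ≤ Q := le_max_left _ _
  set κ : ℝ := 4 + Real.log (6 * Q) / Real.log 2 with hκ
  have hκ4 : 4 ≤ κ := by
    have : 0 ≤ Real.log (6 * Q) / Real.log 2 :=
      div_nonneg (Real.log_nonneg (by linarith)) (Real.log_nonneg one_le_two)
    linarith
  set c₁ : ℝ := M * (5 * κ * √Q + 2 * √(2 * κ)) with hc₁
  have hc₁0 : 0 < c₁ := by positivity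
  set G' : ℝ := max 1 c with hG'
  have hG'1 : 1 ≤ G' := le_max_left _ _
  set D : ℝ := c₁ * √c₂ + 4 * M * G' ^ (ℓ + 1) with hD
  have hD0 : 0 < D := by positivity
  refine ⟨D ^ 2, by positivity, ?_⟩
  intro β L a a₁ hβ hℓ hL ha hLB m n hm hn A hAh _ hA Ω _ P _ τ X Y hS
  have : NeZero m := ⟨by omega⟩
  have : NeZero n := ⟨by omega⟩
  -- For `n = 1` the claimed probability is `0`; from `n = 2` on, `log n` is positive.
  rcases Nat.lt_or_ge n 2 with hn2 | hn2
  · have : n = 1 := by omega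
    subst this
    simp
  have hβℓ : β ≤ ℓ + 1 := by rw [← hℓ]; exact (Nat.lt_floor_add_one β).le
  have hρ0 := rateBase_pos (β := β) (L := L) (a := a) (m := m) (n := n) hβ hL ha hm hn2
  have hb : bandwidth c β L a m n = c * rateBase β L a m n ^ (1 / (2 * β + 1)) := rfl
  set x : ℝ := rateBase β L a m n ^ (1 / (2 * β + 1)) with hx
  have hx0 : 0 < x := Real.rpow_pos_of_pos hρ0 _
  have hx2 : rateBase β L a m n ^ (2 * β / (2 * β + 1)) = x ^ (2 * β) := by
    rw [hx, ← Real.rpow_mul hρ0.le]; congr 1; ring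
  have hρx : rateBase β L a m n = x ^ (2 * β) * x := by
    rw [← Real.rpow_add_one hx0.ne', hx, ← Real.rpow_mul hρ0.le,
      one_div_mul_cancel (by positivity), Real.rpow_one]
  have hxβ : x ^ (2 * β) = (x ^ β) ^ 2 := by
    rw [← Real.rpow_natCast, ← Real.rpow_mul hx0.le]; congr 1; push_cast; ring
  have hxβ0 : 0 < x ^ β := Real.rpow_pos_of_pos hx0 _
  rw [hx2, hb]
  set h : ℝ := c * x with hh
  have hh0 : 0 < h := by positivity
  by_cases hhalf : h ≤ 1 / 2
  · have hratio := sq_mul_variance_ratio_le hc hβ hℓ hL ha hm hn2 hx0 hρx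
    rw [← hh, ← hc₂] at hratio
    set q := (m : ℝ) * Real.log n / (n * h) with hq
    have hlog2 : 0.6931471803 < Real.log 2 := Real.log_two_gt_d9
    have hlog : Real.log 2 ≤ Real.log n := Real.log_le_log two_pos (by exact_mod_cast hn2)
    have hlog0 : 0 < Real.log n := by linarith
    have hq0 : 0 ≤ q := by positivity
    have hxG : x ^ (2 * β) ≤ G ^ (2 * (ℓ + 1)) := by
      refine rpow_two_mul_le_pow hx0.le ?_ (le_max_left _ _) hβ.le hβℓ
      refine le_trans ?_ (le_max_right _ _)
      rw [le_div_iff₀ (by positivity)]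
      linarith
    have hqQ : q ≤ Q := by
      refine le_trans ?_ (le_max_right _ _)
      have hL2 : L ^ 2 ≤ B ^ 2 * a ^ 2 := by
        rw [← mul_pow]; exact pow_le_pow_left₀ hL.le hLB 2
      have : a ^ 2 * q ≤ a ^ 2 * (c₂ * (B ^ 2 * G ^ (2 * (ℓ + 1)))) :=
        calc a ^ 2 * q ≤ c₂ * (L ^ 2 * x ^ (2 * β)) := hratio
          _ ≤ c₂ * ((B ^ 2 * a ^ 2) * G ^ (2 * (ℓ + 1))) := by gcongr
          _ = _ := by ring
      exact le_of_mul_le_mul_left this (by positivity)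
    set r : ℝ := κ * Real.log n with hr
    have hr1 : 1 ≤ r := by nlinarith
    have hprob := union_bound_le hQ1 hn2 hh0 (by linarith) hqQ
    rw [← hκ, ← hr] at hprob
    have key := hS.le_measureReal_kernelEstimator hK hLK hM0 hM ha hβ hℓ hL.le hAh hA hh0
      (r := r) (by linarith)
    refine (sub_le_sub_left hprob 1).trans (key.trans (measureReal_mono fun ω hω t ht => ?_))
    refine (hω t ht).trans ?_
    have hdev := deviationLevel_le (LK := LK) hM0 hh0 ha (by linarith) hm hn hr hr1
      (by rw [hMdef]; linarith) hqQ
    rw [← hc₁, ← hq] at hdev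
    have haq : a * √q ≤ √c₂ * (L * x ^ β) := by
      refine le_of_sq_le_sq ?_ (by positivity)
      rw [mul_pow, mul_pow, mul_pow, Real.sq_sqrt hq0, Real.sq_sqrt hc₂0.le, ← hxβ]
      exact hratio
    have hhβ : h ^ β ≤ G' ^ (ℓ + 1) * x ^ β := by
      rw [hh, Real.mul_rpow hc.le hx0.le]
      refine mul_le_mul_of_nonneg_right ?_ hxβ0.le
      calc c ^ β ≤ G' ^ β := Real.rpow_le_rpow hc.le (le_max_right _ _) hβ.le
        _ ≤ G' ^ ((ℓ + 1 : ℕ) : ℝ) :=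
            Real.rpow_le_rpow_of_exponent_le hG'1 (by push_cast; linarith)
        _ = _ := Real.rpow_natCast _ _
    have hsum : m / (n * h) * (deviationLevel M h a r m n + 2 * LK * a) + 4 * M * L * h ^ β ≤
        D * (L * x ^ β) :=
      calc _ ≤ c₁ * (√c₂ * (L * x ^ β)) + 4 * M * L * (G' ^ (ℓ + 1) * x ^ β) := by
            refine add_le_add (hdev.trans ?_) ?_ <;> gcongr
        _ = _ := by rw [hD]; ring
    have hnn : 0 ≤ m / (n * h) * (deviationLevel M h a r m n + 2 * LK * a) +
        4 * M * L * h ^ β := by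
      unfold deviationLevel
      positivity
    calc _ ≤ (D * (L * x ^ β)) ^ 2 := pow_le_pow_left₀ hnn hsum 2
      _ = _ := by rw [hxβ]; ring
  · have hempty : Icc h (1 - h) = ∅ := Icc_eq_empty (by linarith)
    simp [hempty]
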